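/- Let $(X,J)$ be a compact almost complex manifold, i.e. a compact smooth manifold $X$ without boundary with a smooth bundle endomorphism $J$ of $TX$ such that $J^2=-\mathrm{Id}$, and let $g$ be any smooth Riemannian metric on $X$ (not assumed to be compatible with $J$). Let $S^2=\mathbb{C}\cup\{\infty\}$ be the Riemann sphere with its standard complex structure $\mathfrak{j}$. A smooth map $u\colon S^2\to X$ is called $J$-holomorphic if $\mathrm{d}u\circ\mathfrak{j}=J\circ\mathrm{d}u$, and its energy is $$E_g(u)=\frac12\int_{S^2} g(\mathrm{d}u\otimes_{\mathfrak{j}}\mathrm{d}u)\in[0,\infty],$$ where in a local holomorphic coordinate $z=s+\mathfrak{i}t$ on $S^2$ the 2-form $g(\mathrm{d}u\otimes_{\mathfrak{j}}\mathrm{d}u)$ is $\big(g(\partial_s u,\partial_s u)+g(\partial_t u,\partial_t u)\big)\,\mathrm{d}s\wedge\mathrm{d}t$ (this does not depend on the choice of the coordinate). Then there exists a real number $\hbar_{J,g}>0$ such that $E_g(u)\ge\hbar_{J,g}$ for every non-constant $J$-holomorphic map $u\colon S^2\to X$. -/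

import Mathlib

open Set Filter Topology MeasureTheory
open scoped Manifold ContDiff Bundle ENNReal

/-! ### The Riemann sphere

The sphere `S² = ℂ ∪ {∞}`, with the two holomorphic charts `z` and `1 / z`. -/

/-- The Riemann sphere, i.e. `S²` with its standard complex structure, as a topological space. -/
abbrev RiemannSphere : Type := OnePoint ℂ

namespace RiemannSphere

/-- The inversion `z ↦ 1 / z` of the Riemann sphere, exchanging `0` and `∞`. -/
noncomputable def inversion : RiemannSphere → RiemannSphere
  | OnePoint.infty => ((0 : ℂ) : OnePoint ℂ)
  | OnePoint.some z => if z = 0 then OnePoint.infty else ((z⁻¹ : ℂ) : OnePoint ℂ)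

theorem inversion_infty : inversion OnePoint.infty = ((0 : ℂ) : OnePoint ℂ) := rfl

theorem inversion_coe (z : ℂ) :
    inversion (z : OnePoint ℂ) =
      if z = 0 then OnePoint.infty else ((z⁻¹ : ℂ) : OnePoint ℂ) := rfl

theorem inversion_inversion (p : RiemannSphere) : inversion (inversion p) = p := by
  induction p using OnePoint.rec with
  | infty => simp [inversion_infty, inversion_coe]
  | coe z =>
    by_cases hz : z = 0
    · simp [inversion_infty, inversion_coe, hz]
    · simp [inversion_coe, hz]

theorem continuous_inversion : Continuous inversion := by
  rw [OnePoint.continuous_iff]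
  have hinf : Tendsto (fun z : ℂ => inversion (z : OnePoint ℂ)) (𝓝[≠] (0 : ℂ))
      (𝓝 (OnePoint.infty : OnePoint ℂ)) := by
    have h1 : Tendsto (fun z : ℂ => ((z⁻¹ : ℂ) : OnePoint ℂ)) (𝓝[≠] (0 : ℂ))
        (𝓝 (OnePoint.infty : OnePoint ℂ)) := by
      have h := OnePoint.tendsto_coe_infty (X := ℂ)
      rw [coclosedCompact_eq_cocompact, ← Metric.cobounded_eq_cocompact] at h
      exact h.comp tendsto_inv₀_nhdsNE_zero
    refine h1.congr' ?_
    filter_upwards [self_mem_nhdsWithin] with z hz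
    have hz' : z ≠ 0 := hz
    simp [inversion_coe, hz']
  refine ⟨?_, ?_⟩
  · rw [coclosedCompact_eq_cocompact, ← Metric.cobounded_eq_cocompact, inversion_infty]
    have h1 : Tendsto (fun z : ℂ => ((z⁻¹ : ℂ) : OnePoint ℂ)) (Bornology.cobounded ℂ)
        (𝓝 ((0 : ℂ) : OnePoint ℂ)) :=
      (OnePoint.continuous_coe.tendsto (0 : ℂ)).comp tendsto_inv₀_cobounded
    refine h1.congr' ?_
    have hne : ∀ᶠ z : ℂ in Bornology.cobounded ℂ, z ≠ 0 :=
      Bornology.eventually_ne_cobounded 0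
    filter_upwards [hne] with z hz
    simp [inversion_coe, hz]
  · rw [continuous_iff_continuousAt]
    intro z
    by_cases hz : z = 0
    · subst hz
      have h0 : inversion ((0 : ℂ) : OnePoint ℂ) = OnePoint.infty := by simp [inversion_coe]
      rw [continuousAt_iff_punctured_nhds, h0]
      exact hinf
    · have h1 : ContinuousAt (fun w : ℂ => ((w⁻¹ : ℂ) : OnePoint ℂ)) z :=
        OnePoint.continuous_coe.continuousAt.comp (continuousAt_inv₀ hz)
      refine h1.congr ?_
      filter_upwards [isOpen_ne.mem_nhds hz] with w hw
      have hw' : w ≠ 0 := hw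
      simp [inversion_coe, hw']

/-- The inversion as a self-homeomorphism of the Riemann sphere. -/
noncomputable def inversionHomeomorph : RiemannSphere ≃ₜ RiemannSphere where
  toFun := inversion
  invFun := inversion
  left_inv := inversion_inversion
  right_inv := inversion_inversion
  continuous_toFun := continuous_inversion
  continuous_invFun := continuous_inversion

/-- The affine chart `z`, defined on the complement of `∞`; its inverse is `z ↦ z`. -/
noncomputable def chartZero : OpenPartialHomeomorph RiemannSphere ℂ :=
  (OnePoint.isOpenEmbedding_coe.toOpenPartialHomeomorph ((↑) : ℂ → OnePoint ℂ)).symm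

/-- The chart `1 / z`, defined on the complement of `0`. -/
noncomputable def chartInfty : OpenPartialHomeomorph RiemannSphere ℂ :=
  inversionHomeomorph.toOpenPartialHomeomorph.trans chartZero

theorem chartZero_source : chartZero.source = range ((↑) : ℂ → OnePoint ℂ) := by
  simp [chartZero]

theorem chartZero_target : chartZero.target = univ := by
  simp [chartZero]

theorem chartZero_symm_apply (z : ℂ) : chartZero.symm z = (z : OnePoint ℂ) := by
  simp [chartZero]

theorem chartZero_coe (z : ℂ) : chartZero (z : OnePoint ℂ) = z := by
  have h := chartZero.right_inv (x := z) (by rw [chartZero_target]; trivial)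
  rwa [chartZero_symm_apply] at h

theorem chartInfty_target : chartInfty.target = univ := by
  simp [chartInfty, chartZero_target]

theorem chartInfty_symm_apply (z : ℂ) : chartInfty.symm z = inversion (z : OnePoint ℂ) := by
  simp only [chartInfty, OpenPartialHomeomorph.coe_trans_symm, Function.comp_apply,
    chartZero_symm_apply]
  rfl

theorem chartInfty_apply (p : RiemannSphere) : chartInfty p = chartZero (inversion p) := rfl

theorem chartInfty_source : chartInfty.source = {((0 : ℂ) : OnePoint ℂ)}ᶜ := by
  ext p
  have h : p ∈ chartInfty.source ↔ inversion p ∈ range ((↑) : ℂ → OnePoint ℂ) := by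
    rw [← chartZero_source]
    simp only [chartInfty, OpenPartialHomeomorph.trans_source, mem_inter_iff, mem_preimage]
    exact ⟨fun h => h.2, fun h => ⟨mem_univ _, h⟩⟩
  rw [h]
  induction p using OnePoint.rec with
  | infty => simp [inversion_infty]
  | coe z =>
    by_cases hz : z = 0
    · simp [inversion_coe, hz]
    · simp [inversion_coe, hz]

open scoped Classical in
/-- The atlas consisting of the two charts `z` and `1 / z`. -/
noncomputable instance instChartedSpace : ChartedSpace ℂ RiemannSphere where
  atlas := {chartZero, chartInfty}
  chartAt p := if p = OnePoint.infty then chartInfty else chartZero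
  mem_chart_source p := by
    induction p using OnePoint.rec with
    | infty => simp [chartInfty_source]
    | coe z => simp [chartZero_source]
  chart_mem_atlas p := by
    by_cases hp : p = OnePoint.infty <;> simp [hp]

theorem atlas_eq : atlas ℂ RiemannSphere = {chartZero, chartInfty} := rfl

/-- Both coordinate changes are analytic over every field over which inversion is. -/
theorem contDiffOn_coordChange {𝕜 : Type*} [NontriviallyNormedField 𝕜] [NormedAlgebra 𝕜 ℂ]
    (n : ℕ∞ω) (e e' : OpenPartialHomeomorph RiemannSphere ℂ)
    (he : e ∈ atlas ℂ RiemannSphere) (he' : e' ∈ atlas ℂ RiemannSphere) :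
    ContDiffOn 𝕜 n (e.symm ≫ₕ e') (e.symm ≫ₕ e').source := by
  have hself : ∀ f : OpenPartialHomeomorph RiemannSphere ℂ,
      ContDiffOn 𝕜 n (f.symm ≫ₕ f) (f.symm ≫ₕ f).source := fun f => by
    refine contDiffOn_id.congr fun z hz => ?_
    simp only [OpenPartialHomeomorph.trans_source, OpenPartialHomeomorph.symm_source,
      mem_inter_iff] at hz
    simpa using f.right_inv hz.1
  have hinv : ContDiffOn 𝕜 n (fun z : ℂ => z⁻¹) {0}ᶜ := fun z hz =>
    (contDiffAt_inv 𝕜 (by simpa using hz)).contDiffWithinAt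
  rcases he with rfl | rfl <;> rcases he' with rfl | rfl
  · exact hself _
  · refine (hinv.congr (f₁ := chartZero.symm ≫ₕ chartInfty) fun z hz => ?_).mono fun z hz => ?_
    · have hz' : z ≠ 0 := hz
      simp [chartZero_symm_apply, chartInfty_apply, inversion_coe, hz', chartZero_coe]
    · have h2 := hz.2
      simpa [chartZero_symm_apply, chartInfty_source] using h2
  · refine (hinv.congr (f₁ := chartInfty.symm ≫ₕ chartZero) fun z hz => ?_).mono fun z hz => ?_
    · have hz' : z ≠ 0 := hz
      simp [chartInfty_symm_apply, inversion_coe, hz', chartZero_coe]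
    · have h2 := hz.2
      intro h0
      have h0' : z = 0 := h0
      simp [chartInfty_symm_apply, chartZero_source, inversion_coe, h0'] at h2
  · exact hself _

/-- The Riemann sphere is a Riemann surface. -/
instance instIsManifoldComplex : IsManifold 𝓘(ℂ) ω RiemannSphere :=
  isManifold_of_contDiffOn 𝓘(ℂ) ω RiemannSphere fun e e' he he' => by
    simpa using contDiffOn_coordChange (𝕜 := ℂ) ω e e' he he'

/-- The Riemann sphere is in particular a smooth real surface. -/
instance instIsManifoldReal : IsManifold 𝓘(ℝ, ℂ) ∞ RiemannSphere :=
  isManifold_of_contDiffOn 𝓘(ℝ, ℂ) ∞ RiemannSphere fun e e' he he' => by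
    simpa using contDiffOn_coordChange (𝕜 := ℝ) ∞ e e' he he'

end RiemannSphere

/-! ### Almost complex manifolds, `J`-holomorphic maps, energy -/

section AlmostComplex

variable (E : Type*) [NormedAddCommGroup E] [NormedSpace ℝ E]
  (X : Type*) [TopologicalSpace X] [ChartedSpace E X] [IsManifold 𝓘(ℝ, E) ∞ X]

/-- A (smooth) almost complex structure on a manifold `X`: a smooth section `J` of the
endomorphism bundle of `TX` such that `J² = -id`. -/
structure AlmostComplexStructure where
  /-- The endomorphism `J x` of the tangent space at `x`. -/
  toFun (x : X) : TangentSpace 𝓘(ℝ, E) x →L[ℝ] TangentSpace 𝓘(ℝ, E) x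
  apply_apply (x : X) (v : TangentSpace 𝓘(ℝ, E) x) : toFun x (toFun x v) = -v
  contMDiff : ContMDiff 𝓘(ℝ, E) (𝓘(ℝ, E).prod 𝓘(ℝ, E →L[ℝ] E)) ∞
    (fun x ↦ Bundle.TotalSpace.mk' (E →L[ℝ] E)
      (E := fun x : X ↦ TangentSpace 𝓘(ℝ, E) x →L[ℝ] TangentSpace 𝓘(ℝ, E) x) x (toFun x))

/-- A (smooth) Riemannian metric on the manifold `X`. -/
abbrev SmoothRiemannianMetric :=
  Bundle.ContMDiffRiemannianMetric 𝓘(ℝ, E) ∞ E (fun x : X ↦ TangentSpace 𝓘(ℝ, E) x)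

end AlmostComplex

section Surface

variable {E : Type*} [NormedAddCommGroup E] [NormedSpace ℝ E]
  {X : Type*} [TopologicalSpace X] [ChartedSpace E X] [IsManifold 𝓘(ℝ, E) ∞ X]
  {S : Type*} [TopologicalSpace S] [ChartedSpace ℂ S]

/-- The complex structure `j` in the fibers of `TS` of a Riemann surface `S`. In Mathlib the
tangent space at `p` is `ℂ`, through the preferred chart at `p`; the charts being holomorphic,
`j` is multiplication by `i` there. -/
noncomputable def surfaceComplexStructure [IsManifold 𝓘(ℂ) ω S] (p : S) :
    TangentSpace 𝓘(ℝ, ℂ) p →L[ℝ] TangentSpace 𝓘(ℝ, ℂ) p :=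
  (ContinuousLinearMap.mul ℝ ℂ Complex.I : ℂ →L[ℝ] ℂ)

/-- A map `u` from a Riemann surface to an almost complex manifold is `J`-holomorphic if it is
smooth and `du ∘ j = J ∘ du`. -/
def IsJHolomorphic [IsManifold 𝓘(ℂ) ω S] (J : AlmostComplexStructure E X) (u : S → X) : Prop :=
  ContMDiff 𝓘(ℝ, ℂ) 𝓘(ℝ, E) ∞ u ∧
    ∀ (p : S) (v : TangentSpace 𝓘(ℝ, ℂ) p),
      mfderiv 𝓘(ℝ, ℂ) 𝓘(ℝ, E) u p (surfaceComplexStructure p v) =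
        J.toFun (u p) (mfderiv 𝓘(ℝ, ℂ) 𝓘(ℝ, E) u p v)

/-- The coefficient `½ (g(f_s, f_s) + g(f_t, f_t))` of `ds ∧ dt` in `½ g(df ⊗_j df)`, in a
holomorphic coordinate `φ = s + i t`, at the point with coordinate `z`. -/
noncomputable def energyDensity (g : SmoothRiemannianMetric E X)
    (φ : OpenPartialHomeomorph S ℂ) (f : S → X) (z : ℂ) : ℝ :=
  let D := mfderiv 𝓘(ℝ, ℂ) 𝓘(ℝ, E) (f ∘ φ.symm) z
  (g.inner ((f ∘ φ.symm) z) (D (1 : ℂ)) (D (1 : ℂ)) +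
    g.inner ((f ∘ φ.symm) z) (D Complex.I) (D Complex.I)) / 2

/-- The integral of the nonnegative 2-form `½ g(df ⊗_j df)` over a subset `A` of the domain of the
holomorphic coordinate `φ`. -/
noncomputable def chartEnergy (g : SmoothRiemannianMetric E X)
    (φ : OpenPartialHomeomorph S ℂ) (f : S → X) (A : Set S) : ℝ≥0∞ :=
  ∫⁻ z in φ '' A, ENNReal.ofReal (energyDensity g φ f z)

/-- The energy `E_g(f) = ½ ∫_S g(df ⊗_j df) ∈ [0, ∞]` of a smooth map `f` from a Riemann
surface `S` to a Riemannian manifold `(X, g)`. The 2-form is nonnegative and its integrals in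
different holomorphic coordinates agree, so its integral over `S` is the supremum of its integrals
over finite disjoint unions of Borel sets, each of them contained in a coordinate domain. -/
noncomputable def energy [IsManifold 𝓘(ℂ) ω S] (g : SmoothRiemannianMetric E X) (f : S → X) :
    ℝ≥0∞ :=
  ⨆ (n : ℕ) (φ : Fin n → OpenPartialHomeomorph S ℂ) (A : Fin n → Set S)
    (_ : ∀ i, φ i ∈ atlas ℂ S) (_ : ∀ i, MeasurableSet[borel S] (A i))
    (_ : ∀ i, A i ⊆ (φ i).source) (_ : Pairwise fun i k => Disjoint (A i) (A k)),
    ∑ i, chartEnergy g (φ i) f (A i)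

end Surface

/-! Restrict the sphere to the plane `ℂ`, which can only lower the energy. The restricted map `f` is
still `J`-holomorphic, and it is non-constant because `ℂ` is dense. So it is enough to bound below
the energy of non-constant `J`-holomorphic planes; no behaviour at infinity is used.

Let `e` be the energy density of `f`. It is not identically zero, so a weighted maximum
(`exists_rescaling_point`) gives a point `c` with `e c = Λ ^ 2` such that `e ≤ 4 * Λ ^ 2` on a disk
of radius at least `S / Λ`, for any prescribed `S`. On a disk of radius `R = δ / Λ` with `δ` small,
`f` stays in one chart (`mem_chart_of_norm_fderiv_le`) and solves a Cauchy-Riemann equation whose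
complex structure differs from that at `c` by `O(Λ r)` at distance `r` from `c`.

Comparing with the Cauchy formula for the structure frozen at `c` gives a mean value inequality for
the derivative (`norm_center_le`), with error `O(Λ ^ 2 * r)`. For small `δ` this error is absorbed
by the main term, of order `Λ`. Squaring and integrating over the disk bounds the energy below by a
multiple of `(Λ * R) ^ 2 = δ ^ 2`, in which `Λ` no longer appears (`exists_energyLowerBoundAt`).
Compactness of `X` makes the constants uniform (`exists_forall_energyLowerBoundAt`). -/

/-! ### Perturbed Cauchy formula and mean value inequality on a disk. -/

section CauchyRiemann

variable {E : Type*} [NormedAddCommGroup E] [NormedSpace ℝ E]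

/-- The operator `exp (-θ J)`, where `J ^ 2 = -1`. -/
noncomputable def expNegRotation (J : E →L[ℝ] E) (θ : ℝ) : E →L[ℝ] E :=
  Real.cos θ • ContinuousLinearMap.id ℝ E - Real.sin θ • J

theorem expNegRotation_apply (J : E →L[ℝ] E) (θ : ℝ) (x : E) :
    expNegRotation J θ x = Real.cos θ • x - Real.sin θ • J x := by
  simp [expNegRotation]

theorem continuous_expNegRotation (J : E →L[ℝ] E) : Continuous (expNegRotation J) := by
  unfold expNegRotation; fun_prop

theorem norm_expNegRotation_apply_le (J : E →L[ℝ] E) (θ : ℝ) (x : E) :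
    ‖expNegRotation J θ x‖ ≤ (1 + ‖J‖) * ‖x‖ := by
  rw [expNegRotation_apply]
  calc ‖Real.cos θ • x - Real.sin θ • J x‖
      ≤ ‖Real.cos θ • x‖ + ‖Real.sin θ • J x‖ := norm_sub_le _ _
    _ ≤ 1 * ‖x‖ + 1 * (‖J‖ * ‖x‖) := by
        rw [norm_smul, norm_smul]
        gcongr
        · exact Real.abs_cos_le_one θ
        · exact Real.abs_sin_le_one θ
        · exact J.le_opNorm x
    _ = (1 + ‖J‖) * ‖x‖ := by ring

theorem hasDerivAt_circleMap_radius (c : ℂ) (r θ : ℝ) :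
    HasDerivAt (fun s : ℝ => circleMap c s θ) (circleMap 0 1 θ) r := by
  have h : HasDerivAt (fun s : ℝ => c + (s : ℂ) * Complex.exp (θ * Complex.I))
      (1 * Complex.exp (θ * Complex.I)) r :=
    ((Complex.ofRealCLM.hasDerivAt (x := r)).mul_const _).const_add c
  simpa [circleMap] using h

theorem circleMap_mem_ball_of_abs_lt {c : ℂ} {r R : ℝ} (h : |r| < R) (θ : ℝ) :
    circleMap c r θ ∈ Metric.ball c R := by
  simpa [Metric.mem_ball, dist_eq_norm, norm_sub_rev, circleMap] using h

/-- A solution of the Cauchy-Riemann equation for a variable complex structure `A`, near a point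
where `A` agrees to first order with a fixed one. -/
structure CauchyRiemannOnBall (v : ℂ → E) (D : ℂ → ℂ →L[ℝ] E) (A : ℂ → E →L[ℝ] E)
    (J : E →L[ℝ] E) (c : ℂ) (R L Λ : ℝ) : Prop where
  hasFDerivAt : ∀ z ∈ Metric.ball c R, HasFDerivAt v (D z) z
  continuousOn : ContinuousOn D (Metric.ball c R)
  cauchyRiemann : ∀ z ∈ Metric.ball c R, ∀ w, D z (Complex.I * w) = A z (D z w)
  sq_eq : ∀ x, J (J x) = -x
  norm_sub_le : ∀ z ∈ Metric.ball c R, ‖A z - J‖ ≤ L * ‖v z - v c‖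
  norm_le : ∀ z ∈ Metric.ball c R, ‖D z‖ ≤ Λ
  radius_pos : 0 < R
  lipschitz_nonneg : 0 ≤ L

namespace CauchyRiemannOnBall

variable {v : ℂ → E} {D : ℂ → ℂ →L[ℝ] E} {A : ℂ → E →L[ℝ] E} {J : E →L[ℝ] E} {c : ℂ} {R L Λ : ℝ}

theorem bound_nonneg (h : CauchyRiemannOnBall v D A J c R L Λ) : 0 ≤ Λ :=
  (norm_nonneg _).trans (h.norm_le c (Metric.mem_ball_self h.radius_pos))

theorem apply_I_center (h : CauchyRiemannOnBall v D A J c R L Λ) (w : ℂ) :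
    D c (Complex.I * w) = J (D c w) := by
  have hc := Metric.mem_ball_self (x := c) h.radius_pos
  have h1 := h.norm_sub_le c hc
  rw [sub_self, norm_zero, mul_zero, norm_le_zero_iff, sub_eq_zero] at h1
  rw [h.cauchyRiemann c hc, h1]

theorem continuous_circle (h : CauchyRiemannOnBall v D A J c R L Λ) {r : ℝ} (hr : |r| < R) :
    Continuous fun θ => v (circleMap c r θ) := by
  rw [continuous_iff_continuousAt]
  intro θ
  exact ContinuousAt.comp (f := circleMap c r)
    (h.hasFDerivAt _ (circleMap_mem_ball_of_abs_lt hr θ)).continuousAt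
    (continuous_circleMap c r).continuousAt

theorem continuous_circle_fderiv (h : CauchyRiemannOnBall v D A J c R L Λ) {r : ℝ}
    (hr : |r| < R) : Continuous fun θ => D (circleMap c r θ) :=
  h.continuousOn.comp_continuous (continuous_circleMap c r)
    fun θ => circleMap_mem_ball_of_abs_lt hr θ

theorem norm_sub_center_le (h : CauchyRiemannOnBall v D A J c R L Λ) {z : ℂ}
    (hz : z ∈ Metric.ball c R) : ‖v z - v c‖ ≤ Λ * ‖z - c‖ :=
  (convex_ball c R).norm_image_sub_le_of_norm_hasFDerivWithin_le
    (fun x hx => (h.hasFDerivAt x hx).hasFDerivWithinAt) h.norm_le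
    (Metric.mem_ball_self h.radius_pos) hz

/-- The first Fourier coefficient of `v` on the circle of radius `r`. -/
noncomputable def fourierOne (v : ℂ → E) (J : E →L[ℝ] E) (c : ℂ) (r : ℝ) : E :=
  ∫ θ in (0 : ℝ)..2 * Real.pi, expNegRotation J θ (v (circleMap c r θ) - v c)

/-- Differentiation under the integral, dominated by `(1 + ‖J‖) * Λ`. Negative radii are allowed so
that `r = 0` is an interior point. -/
theorem hasDerivAt_fourierOne (h : CauchyRiemannOnBall v D A J c R L Λ) {r : ℝ} (hr : |r| < R) :
    HasDerivAt (fourierOne v J c)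
      (∫ θ in (0 : ℝ)..2 * Real.pi, expNegRotation J θ (D (circleMap c r θ) (circleMap 0 1 θ)))
      r := by
  have hs : {s : ℝ | |s| < R} ∈ 𝓝 r := (isOpen_lt continuous_abs continuous_const).mem_nhds hr
  have hcont : ∀ s : ℝ, |s| < R →
      Continuous fun θ => expNegRotation J θ (v (circleMap c s θ) - v c) := fun s hs =>
    (continuous_expNegRotation J).clm_apply ((h.continuous_circle hs).sub continuous_const)
  refine (intervalIntegral.hasDerivAt_integral_of_dominated_loc_of_deriv_le
    (F := fun s θ => expNegRotation J θ (v (circleMap c s θ) - v c))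
    (F' := fun s θ => expNegRotation J θ (D (circleMap c s θ) (circleMap 0 1 θ)))
    (bound := fun _ => (1 + ‖J‖) * Λ) hs ?_ ?_ ?_ ?_ ?_ ?_).2
  · filter_upwards [hs] with s hs
    exact (hcont s hs).aestronglyMeasurable
  · exact (hcont r hr).intervalIntegrable _ _
  · exact ((continuous_expNegRotation J).clm_apply
      ((h.continuous_circle_fderiv hr).clm_apply (continuous_circleMap 0 1))).aestronglyMeasurable
  · refine Eventually.of_forall fun θ _ s hs => ?_
    refine (norm_expNegRotation_apply_le J θ _).trans ?_
    gcongr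
    refine ((D _).le_opNorm _).trans ?_
    simpa using h.norm_le _ (circleMap_mem_ball_of_abs_lt hs θ)
  · exact _root_.intervalIntegrable_const
  · refine Eventually.of_forall fun θ _ s hs => ?_
    have h1 := (h.hasFDerivAt _ (circleMap_mem_ball_of_abs_lt hs θ)).comp_hasDerivAt s
      (hasDerivAt_circleMap_radius c s θ)
    exact (expNegRotation J θ).hasFDerivAt.comp_hasDerivAt s (h1.sub_const (v c))

/-- Integration by parts in `θ`: `exp (-θ J)` has the primitive `sin θ + cos θ J = exp (-θ J) J`,
and the boundary terms cancel by periodicity. -/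
theorem fourierOne_eq [CompleteSpace E] (h : CauchyRiemannOnBall v D A J c R L Λ) {r : ℝ}
    (hr : |r| < R) :
    fourierOne v J c r = -∫ θ in (0 : ℝ)..2 * Real.pi,
      r • expNegRotation J θ (J (D (circleMap c r θ) (Complex.I * circleMap 0 1 θ))) := by
  have hV : ∀ θ, HasDerivAt (fun θ => v (circleMap c r θ) - v c)
      (r • D (circleMap c r θ) (Complex.I * circleMap 0 1 θ)) θ := fun θ => by
    have h1 := (h.hasFDerivAt _ (circleMap_mem_ball_of_abs_lt hr θ)).comp_hasDerivAt θ
      (hasDerivAt_circleMap c r θ)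
    have h2 : circleMap 0 r θ * Complex.I = r • (Complex.I * circleMap 0 1 θ) := by
      simp [circleMap]; ring
    rw [h2, map_smul] at h1
    exact h1.sub_const (v c)
  have hc1 : Continuous fun θ => expNegRotation J θ (v (circleMap c r θ) - v c) :=
    (continuous_expNegRotation J).clm_apply ((h.continuous_circle hr).sub continuous_const)
  have hc2 : Continuous fun θ =>
      r • expNegRotation J θ (J (D (circleMap c r θ) (Complex.I * circleMap 0 1 θ))) :=
    ((continuous_expNegRotation J).clm_apply (J.continuous.comp
      ((h.continuous_circle_fderiv hr).clm_apply
        (continuous_const.mul (continuous_circleMap 0 1))))).const_smul r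
  have hder : ∀ θ ∈ uIcc 0 (2 * Real.pi), HasDerivAt
      (fun θ => Real.sin θ • (v (circleMap c r θ) - v c)
        + Real.cos θ • J (v (circleMap c r θ) - v c))
      (expNegRotation J θ (v (circleMap c r θ) - v c) +
        r • expNegRotation J θ (J (D (circleMap c r θ) (Complex.I * circleMap 0 1 θ)))) θ := by
    intro θ _
    have h1 := ((Real.hasDerivAt_sin θ).smul (hV θ)).add
      ((Real.hasDerivAt_cos θ).smul (J.hasFDerivAt.comp_hasDerivAt θ (hV θ)))
    refine h1.congr_deriv ?_
    simp only [expNegRotation_apply, h.sq_eq, map_smul, smul_neg, neg_smul, Function.comp_apply]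
    module
  have hint := intervalIntegral.integral_eq_sub_of_hasDerivAt hder
    ((hc1.add hc2).intervalIntegrable _ _)
  have hper : circleMap c r (2 * Real.pi) = circleMap c r 0 := by
    simpa using periodic_circleMap c r 0
  rw [intervalIntegral.integral_add (hc1.intervalIntegrable _ _) (hc2.intervalIntegrable _ _),
    hper, Real.sin_two_pi, Real.cos_two_pi, Real.sin_zero, Real.cos_zero, sub_self] at hint
  exact eq_neg_of_add_eq_zero_left hint

/-- The bound for the error term of the Cauchy formula, up to the factor `Λ ^ 2 * r ^ 2`. -/
noncomputable def errorConst (J : E →L[ℝ] E) (L : ℝ) : ℝ :=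
  2 * Real.pi * ((1 + ‖J‖) * (‖J‖ * L))

/-- With `F = fourierOne v J c`, the integrand of `r F' - F` is `r exp (-θ J)` applied to `D w + J
(D (i w)) = J ((A - J) (D w))`, where `w = exp (i θ)`. It would vanish for `A = J`; in general `‖A -
J‖ ≤ L * Λ * r`, which makes the error quadratic in `r`. -/
theorem norm_smul_deriv_sub_fourierOne_le [CompleteSpace E]
    (h : CauchyRiemannOnBall v D A J c R L Λ) {r : ℝ} (hr0 : 0 ≤ r) (hr : r < R) :
    ‖r • (∫ θ in (0 : ℝ)..2 * Real.pi,
        expNegRotation J θ (D (circleMap c r θ) (circleMap 0 1 θ))) - fourierOne v J c r‖ ≤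
      errorConst J L * Λ ^ 2 * r ^ 2 := by
  have hr' : |r| < R := by rwa [abs_of_nonneg hr0]
  have hL := h.lipschitz_nonneg
  have hΛ := h.bound_nonneg
  have hc1 : Continuous fun θ =>
      r • expNegRotation J θ (D (circleMap c r θ) (circleMap 0 1 θ)) :=
    ((continuous_expNegRotation J).clm_apply
      ((h.continuous_circle_fderiv hr').clm_apply (continuous_circleMap 0 1))).const_smul r
  have hc2 : Continuous fun θ =>
      r • expNegRotation J θ (J (D (circleMap c r θ) (Complex.I * circleMap 0 1 θ))) :=
    ((continuous_expNegRotation J).clm_apply (J.continuous.comp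
      ((h.continuous_circle_fderiv hr').clm_apply
        (continuous_const.mul (continuous_circleMap 0 1))))).const_smul r
  rw [h.fourierOne_eq hr', sub_neg_eq_add, ← intervalIntegral.integral_smul,
    ← intervalIntegral.integral_add (hc1.intervalIntegrable _ _) (hc2.intervalIntegrable _ _)]
  have hb := intervalIntegral.norm_integral_le_of_norm_le_const (a := 0) (b := 2 * Real.pi)
    (C := (1 + ‖J‖) * (‖J‖ * L) * Λ ^ 2 * r ^ 2)
    (f := fun θ => r • expNegRotation J θ (D (circleMap c r θ) (circleMap 0 1 θ)) +
      r • expNegRotation J θ (J (D (circleMap c r θ) (Complex.I * circleMap 0 1 θ)))) ?_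
  · refine hb.trans (le_of_eq ?_)
    rw [sub_zero, abs_of_pos Real.two_pi_pos, errorConst]; ring
  intro θ _
  set z := circleMap c r θ with hzdef
  have hz : z ∈ Metric.ball c R := circleMap_mem_ball_of_abs_lt hr' θ
  have hzc : ‖z - c‖ = r := by simp [hzdef, circleMap, abs_of_nonneg hr0]
  have he : D z (circleMap 0 1 θ) + J (D z (Complex.I * circleMap 0 1 θ)) =
      J ((A z - J) (D z (circleMap 0 1 θ))) := by
    rw [h.cauchyRiemann z hz, sub_apply, map_sub, h.sq_eq]; abel
  have h1 : ‖D z (circleMap 0 1 θ)‖ ≤ Λ :=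
    ((D z).le_opNorm _).trans (by simpa using h.norm_le z hz)
  have h2 : ‖A z - J‖ ≤ L * (Λ * r) := by
    refine (h.norm_sub_le z hz).trans ?_
    have := h.norm_sub_center_le hz
    rw [hzc] at this
    gcongr
  rw [← smul_add, ← map_add, he, norm_smul, Real.norm_of_nonneg hr0]
  calc r * ‖expNegRotation J θ (J ((A z - J) (D z (circleMap 0 1 θ))))‖
      ≤ r * ((1 + ‖J‖) * (‖J‖ * (L * (Λ * r) * Λ))) := by
        gcongr
        refine (norm_expNegRotation_apply_le J θ _).trans ?_
        gcongr
        refine (J.le_opNorm _).trans ?_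
        gcongr
        refine ((A z - J).le_opNorm _).trans ?_
        gcongr
    _ = _ := by ring

/-- The limit is the derivative of `fourierOne` at `0`. At the center `D c` intertwines `i` and `J`,
so `exp (-θ J)` undoes the rotation of the direction and the integrand is the constant `D c 1`. -/
theorem tendsto_inv_smul_fourierOne [CompleteSpace E] (h : CauchyRiemannOnBall v D A J c R L Λ) :
    Tendsto (fun r : ℝ => r⁻¹ • fourierOne v J c r) (𝓝[>] 0) (𝓝 ((2 * Real.pi) • D c 1)) := by
  have h0 : fourierOne v J c 0 = 0 := by simp [fourierOne]
  have hd := h.hasDerivAt_fourierOne (r := 0) (by simpa using h.radius_pos)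
  have hval : (∫ θ in (0 : ℝ)..2 * Real.pi,
      expNegRotation J θ (D (circleMap c 0 θ) (circleMap 0 1 θ))) = (2 * Real.pi) • D c 1 := by
    have : ∀ θ : ℝ, expNegRotation J θ (D (circleMap c 0 θ) (circleMap 0 1 θ)) = D c 1 := by
      intro θ
      have h1 : circleMap 0 1 θ = Real.cos θ • (1 : ℂ) + Real.sin θ • (Complex.I * 1) := by
        simp [circleMap, Complex.exp_mul_I]
      have h2 := Real.cos_sq_add_sin_sq θ
      rw [h1, map_add, map_smul, map_smul]
      simp only [circleMap_zero_radius, Function.const_apply]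
      rw [h.apply_I_center, expNegRotation_apply]
      simp only [map_add, map_smul, h.sq_eq]
      have h3 : D c 1 = (Real.cos θ ^ 2 + Real.sin θ ^ 2) • D c 1 := by rw [h2, one_smul]
      conv_rhs => rw [h3]
      module
    rw [intervalIntegral.integral_congr fun θ _ => this θ, intervalIntegral.integral_const, sub_zero]
  rw [hval, hasDerivAt_iff_tendsto_slope] at hd
  refine (hd.mono_left (nhdsWithin_mono 0 fun x hx => ne_of_gt hx)).congr fun r => ?_
  simp [slope_def_module, h0]

/-- The mean value inequality for the derivative of a solution of the Cauchy-Riemann equation. -/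
theorem norm_center_le [CompleteSpace E] (h : CauchyRiemannOnBall v D A J c R L Λ) {r : ℝ}
    (hr0 : 0 < r) (hr : r < R) :
    2 * Real.pi * ‖D c 1‖ ≤ (1 + ‖J‖) * (∫ θ in (0 : ℝ)..2 * Real.pi, ‖D (circleMap c r θ)‖) +
      2 * (errorConst J L * Λ ^ 2) * r := by
  set B := errorConst J L * Λ ^ 2 with hB
  set φ : ℝ → E := fun s => s⁻¹ • fourierOne v J c s with hφ
  -- The derivative of `F s / s` is `(s F' - F) / s ^ 2`, so the quadratic error makes `φ` Lipschitz
  -- up to `s = 0`.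
  have hφd : ∀ s ∈ Ioo 0 R, ∃ d, HasDerivAt φ d s ∧ ‖d‖ ≤ B := by
    intro s hs
    have hs' : |s| < R := by rw [abs_of_pos hs.1]; exact hs.2
    have h1 := (hasDerivAt_inv hs.1.ne').smul (h.hasDerivAt_fourierOne hs')
    refine ⟨_, h1, ?_⟩
    have h2 := h.norm_smul_deriv_sub_fourierOne_le hs.1.le hs.2
    set G := ∫ θ in (0 : ℝ)..2 * Real.pi,
      expNegRotation J θ (D (circleMap c s θ) (circleMap 0 1 θ))
    have h3 : s⁻¹ • G + (-(s ^ 2)⁻¹) • fourierOne v J c s =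
        (s ^ 2)⁻¹ • (s • G - fourierOne v J c s) := by
      rw [smul_sub, smul_smul, neg_smul, ← sub_eq_add_neg]
      congr 2
      have := hs.1.ne'
      field_simp
    rw [h3, norm_smul, Real.norm_of_nonneg (by positivity)]
    have hs2 : 0 < s ^ 2 := pow_pos hs.1 2
    rw [inv_mul_le_iff₀ hs2]
    linarith
  have hstep : ∀ s ∈ Ioo 0 r, ‖φ r - φ s‖ ≤ B * r := by
    intro s hs
    have h1 : ∀ x ∈ Icc s r, ∃ d, HasDerivAt φ d x ∧ ‖d‖ ≤ B := fun x hx =>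
      hφd x ⟨hs.1.trans_le hx.1, hx.2.trans_lt hr⟩
    choose! φ' h2 h3 using h1
    have h4 := norm_image_sub_le_of_norm_deriv_le_segment' (f := φ) (f' := φ')
      (fun x hx => (h2 x hx).hasDerivWithinAt) (fun x hx => h3 x ⟨hx.1, hx.2.le⟩) r ⟨hs.2.le, le_rfl⟩
    have hB0 : 0 ≤ B := (norm_nonneg _).trans (h3 r ⟨hs.2.le, le_rfl⟩)
    refine h4.trans ?_
    have := hs.1
    gcongr
    linarith
  have hlim : ‖φ r - (2 * Real.pi) • D c 1‖ ≤ B * r := by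
    refine le_of_tendsto ((tendsto_const_nhds.sub h.tendsto_inv_smul_fourierOne).norm) ?_
    filter_upwards [Ioo_mem_nhdsGT hr0] with s hs using hstep s hs
  have hr' : |r| < R := by rwa [abs_of_pos hr0]
  have hφr : ‖φ r‖ ≤ (1 + ‖J‖) * (∫ θ in (0 : ℝ)..2 * Real.pi, ‖D (circleMap c r θ)‖) + B * r := by
    have h2 := h.norm_smul_deriv_sub_fourierOne_le hr0.le hr
    set G := ∫ θ in (0 : ℝ)..2 * Real.pi,
      expNegRotation J θ (D (circleMap c r θ) (circleMap 0 1 θ)) with hG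
    have hG' : ‖G‖ ≤ (1 + ‖J‖) * (∫ θ in (0 : ℝ)..2 * Real.pi, ‖D (circleMap c r θ)‖) := by
      rw [← intervalIntegral.integral_const_mul]
      refine intervalIntegral.norm_integral_le_of_norm_le Real.two_pi_pos.le ?_
        ((((h.continuous_circle_fderiv hr').norm).const_mul _).intervalIntegrable _ _)
      refine Eventually.of_forall fun θ _ => ?_
      refine (norm_expNegRotation_apply_le J θ _).trans ?_
      gcongr
      simpa using (D (circleMap c r θ)).le_opNorm (circleMap 0 1 θ)
    -- Trading `F r / r` for `F' r = G`, which involves only the derivative of `v`, costs the error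
    -- bound a second time; hence the factor `2`.
    have h5 : φ r = G - r⁻¹ • (r • G - fourierOne v J c r) := by
      rw [smul_sub, smul_smul, inv_mul_cancel₀ hr0.ne', one_smul]; simp [hφ]
    have h6 : ‖r⁻¹ • (r • G - fourierOne v J c r)‖ ≤ B * r := by
      rw [norm_smul, Real.norm_of_nonneg (by positivity), inv_mul_le_iff₀ hr0]
      linarith
    rw [h5]
    exact (_root_.norm_sub_le _ _).trans (add_le_add hG' h6)
  have h7 : 2 * Real.pi * ‖D c 1‖ = ‖(2 * Real.pi) • D c 1‖ := by
    rw [norm_smul, Real.norm_of_nonneg Real.two_pi_pos.le]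
  have h8 : ‖(2 * Real.pi) • D c 1‖ ≤ ‖φ r‖ + ‖φ r - (2 * Real.pi) • D c 1‖ := by
    have := _root_.norm_sub_le (φ r) (φ r - (2 * Real.pi) • D c 1)
    rwa [sub_sub_cancel] at this
  linarith

/-- The smallness condition on `r` lets the error consume at most half of the main term `2 * π * α *
Λ`. What remains bounds the mean of `‖D‖` on the circle below by `τ`, hence the mean of its square
by `τ ^ 2`. -/
theorem two_pi_sq_le_integral_norm_sq [CompleteSpace E]
    (h : CauchyRiemannOnBall v D A J c R L Λ) {r α : ℝ} (hr0 : 0 < r) (hr : r < R)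
    (hα : α * Λ ≤ ‖D c 1‖) (hα0 : 0 ≤ α) (hrα : 2 * errorConst J L * Λ * r ≤ Real.pi * α) :
    2 * Real.pi * (α * Λ / (2 * (1 + ‖J‖))) ^ 2 ≤
      ∫ θ in (-Real.pi)..Real.pi, ‖D (circleMap c r θ)‖ ^ 2 := by
  have hr' : |r| < R := by rwa [abs_of_pos hr0]
  have hΛ := h.bound_nonneg
  have hk : 0 < 1 + ‖J‖ := by positivity
  set τ := α * Λ / (2 * (1 + ‖J‖)) with hτ
  have hτ0 : 0 ≤ τ := by positivity
  have hc := (h.continuous_circle_fderiv hr').norm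
  have h1 := h.norm_center_le hr0 hr
  -- The angle range is moved to that of `polarCoord`.
  have hper : ∫ θ in (0 : ℝ)..2 * Real.pi, ‖D (circleMap c r θ)‖ =
      ∫ θ in (-Real.pi)..Real.pi, ‖D (circleMap c r θ)‖ := by
    have hp : Function.Periodic (fun θ => ‖D (circleMap c r θ)‖) (2 * Real.pi) := fun θ => by
      simp only [periodic_circleMap c r θ]
    have := hp.intervalIntegral_add_eq 0 (-Real.pi)
    rwa [zero_add, show -Real.pi + 2 * Real.pi = Real.pi by ring] at this
  rw [hper] at h1
  set I := ∫ θ in (-Real.pi)..Real.pi, ‖D (circleMap c r θ)‖ with hI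
  have h2 : 2 * Real.pi * τ ≤ I := by
    have h3 : Real.pi * (α * Λ) ≤ (1 + ‖J‖) * I := by
      have h4 : 2 * (errorConst J L * Λ ^ 2) * r ≤ Real.pi * α * Λ := by
        calc 2 * (errorConst J L * Λ ^ 2) * r = 2 * errorConst J L * Λ * r * Λ := by ring
          _ ≤ Real.pi * α * Λ := by gcongr
      have h5 : 2 * Real.pi * (α * Λ) ≤ 2 * Real.pi * ‖D c 1‖ := by
        gcongr
      linarith
    have h6 : 2 * Real.pi * τ = Real.pi * (α * Λ) / (1 + ‖J‖) := by
      rw [hτ]; field_simp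
    rw [h6, div_le_iff₀ hk]
    linarith
  -- Tangent-line form of Jensen: `x ^ 2 ≥ 2 * τ * x - τ ^ 2`.
  have h7 : ∫ θ in (-Real.pi)..Real.pi, (2 * τ * ‖D (circleMap c r θ)‖ - τ ^ 2) ≤
      ∫ θ in (-Real.pi)..Real.pi, ‖D (circleMap c r θ)‖ ^ 2 := by
    refine intervalIntegral.integral_mono_on (by linarith [Real.pi_pos])
      (((hc.const_mul _).sub continuous_const).intervalIntegrable _ _)
      ((hc.pow 2).intervalIntegrable _ _) fun θ _ => ?_
    nlinarith [sq_nonneg (‖D (circleMap c r θ)‖ - τ)]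
  rw [intervalIntegral.integral_sub ((hc.const_mul _).intervalIntegrable _ _)
    (continuous_const.intervalIntegrable _ _), intervalIntegral.integral_const_mul,
    intervalIntegral.integral_const, ← hI, smul_eq_mul] at h7
  have h8 : 2 * τ * (2 * Real.pi * τ) ≤ 2 * τ * I := by gcongr
  nlinarith

end CauchyRiemannOnBall

/-! ### From circles to disks by polar coordinates. -/

theorem lintegral_circleMap_le (F : ℂ → ℝ≥0∞) (c : ℂ) {R : ℝ}
    (hF : AEMeasurable (fun p : ℝ × ℝ => F (circleMap c p.1 p.2))
      (volume.restrict (Ioo 0 R ×ˢ Ioo (-Real.pi) Real.pi))) :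
    ∫⁻ r in Ioo 0 R, ENNReal.ofReal r * ∫⁻ θ in Ioo (-Real.pi) Real.pi, F (circleMap c r θ) ≤
      ∫⁻ z in Metric.ball c R, F z := by
  have h1 : ∫⁻ z in Metric.ball c R, F z =
      ∫⁻ p in polarCoord.target, ENNReal.ofReal p.1 •
        (Metric.ball c R).indicator F (c + Complex.polarCoord.symm p) := by
    rw [Complex.lintegral_comp_polarCoord_symm
      fun w => (Metric.ball c R).indicator F (c + w),
      lintegral_add_left_eq_self, lintegral_indicator Metric.isOpen_ball.measurableSet]
  have hcm : ∀ p : ℝ × ℝ, c + Complex.polarCoord.symm p = circleMap c p.1 p.2 := fun p => by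
    simp [Complex.polarCoord_symm_apply, circleMap, Complex.exp_mul_I]
  have h2 : ∫⁻ p in Ioo 0 R ×ˢ Ioo (-Real.pi) Real.pi,
      ENNReal.ofReal p.1 * F (circleMap c p.1 p.2) ≤ ∫⁻ z in Metric.ball c R, F z := by
    rw [h1]
    refine le_trans (le_of_eq ?_) (lintegral_mono_set
      (s := Ioo 0 R ×ˢ Ioo (-Real.pi) Real.pi) ?_)
    · refine setLIntegral_congr_fun (measurableSet_Ioo.prod measurableSet_Ioo) fun p hp => ?_
      have hp' : circleMap c p.1 p.2 ∈ Metric.ball c R :=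
        circleMap_mem_ball_of_abs_lt (by rw [abs_of_pos hp.1.1]; exact hp.1.2) _
      simp only [hcm, indicator_of_mem hp', smul_eq_mul]
    · rw [polarCoord_target]
      exact prod_mono (fun x hx => hx.1) le_rfl
  refine le_trans (le_of_eq ?_) h2
  rw [Measure.volume_eq_prod, ← Measure.prod_restrict, lintegral_prod]
  · refine lintegral_congr fun r => ?_
    rw [lintegral_const_mul' _ _ ENNReal.ofReal_ne_top]
  · rw [Measure.prod_restrict, ← Measure.volume_eq_prod]
    exact (ENNReal.measurable_ofReal.comp measurable_fst).aemeasurable.mul hF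

namespace CauchyRiemannOnBall

variable {v : ℂ → E} {D : ℂ → ℂ →L[ℝ] E} {A : ℂ → E →L[ℝ] E} {J : E →L[ℝ] E} {c : ℂ} {R L Λ : ℝ}

/-- The circle bound `2 * π * τ ^ 2` is integrated against `r dr` over `(0, R)`. The result depends
on `Λ` and `R` only through `Λ * R`, which is the conformal invariance of energy. -/
theorem le_lintegral_norm_sq [CompleteSpace E]
    (h : CauchyRiemannOnBall v D A J c R L Λ) {α : ℝ}
    (hα : α * Λ ≤ ‖D c 1‖) (hα0 : 0 ≤ α) (hRα : 2 * errorConst J L * Λ * R ≤ Real.pi * α) :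
    ENNReal.ofReal (Real.pi * (α * Λ / (2 * (1 + ‖J‖))) ^ 2 * R ^ 2) ≤
      ∫⁻ z in Metric.ball c R, ENNReal.ofReal (‖D z‖ ^ 2) := by
  set τ := α * Λ / (2 * (1 + ‖J‖)) with hτ
  have hmeas : AEMeasurable (fun p : ℝ × ℝ => ENNReal.ofReal (‖D (circleMap c p.1 p.2)‖ ^ 2))
      (volume.restrict (Ioo 0 R ×ˢ Ioo (-Real.pi) Real.pi)) := by
    refine ENNReal.measurable_ofReal.comp_aemeasurable (ContinuousOn.aemeasurable ?_
      (measurableSet_Ioo.prod measurableSet_Ioo))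
    refine ((h.continuousOn.comp (f := fun p : ℝ × ℝ => circleMap c p.1 p.2) ?_ ?_).norm).pow 2
    · simp only [circleMap]; fun_prop
    · exact fun p hp => circleMap_mem_ball_of_abs_lt (by rw [abs_of_pos hp.1.1]; exact hp.1.2) _
  refine le_trans ?_ (lintegral_circleMap_le (fun z => ENNReal.ofReal (‖D z‖ ^ 2)) c hmeas)
  have hin : ∀ r ∈ Ioo 0 R, ENNReal.ofReal (2 * Real.pi * τ ^ 2) ≤
      ∫⁻ θ in Ioo (-Real.pi) Real.pi, ENNReal.ofReal (‖D (circleMap c r θ)‖ ^ 2) := by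
    intro r hr
    have hr' : |r| < R := by rw [abs_of_pos hr.1]; exact hr.2
    have hk : 0 ≤ 2 * errorConst J L * Λ := by
      have := h.bound_nonneg
      have := h.lipschitz_nonneg
      unfold errorConst; positivity
    have h1 := h.two_pi_sq_le_integral_norm_sq hr.1 hr.2 hα hα0
      ((mul_le_mul_of_nonneg_left hr.2.le hk).trans hRα)
    have hc := ((h.continuous_circle_fderiv hr').norm).pow 2
    rw [intervalIntegral.integral_of_le (by linarith [Real.pi_pos]),
      ← restrict_Ioo_eq_restrict_Ioc] at h1
    refine (ENNReal.ofReal_le_ofReal h1).trans (le_of_eq ?_)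
    refine ofReal_integral_eq_lintegral_ofReal ?_ (Eventually.of_forall fun θ => by positivity)
    exact (hc.integrableOn_Icc).mono_set Ioo_subset_Icc_self
  calc ENNReal.ofReal (Real.pi * τ ^ 2 * R ^ 2)
      = ∫⁻ r in Ioo 0 R, ENNReal.ofReal r * ENNReal.ofReal (2 * Real.pi * τ ^ 2) := by
        have h2 : ∀ r ∈ Ioo 0 R, ENNReal.ofReal r * ENNReal.ofReal (2 * Real.pi * τ ^ 2) =
            ENNReal.ofReal (r * (2 * Real.pi * τ ^ 2)) := fun r hr =>
          (ENNReal.ofReal_mul hr.1.le).symm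
        rw [setLIntegral_congr_fun measurableSet_Ioo h2,
          ← ofReal_integral_eq_lintegral_ofReal, restrict_Ioo_eq_restrict_Ioc,
          ← intervalIntegral.integral_of_le h.radius_pos.le,
          intervalIntegral.integral_mul_const, integral_id]
        · congr 1; ring
        · exact ((continuous_id.mul continuous_const).integrableOn_Icc).mono_set Ioo_subset_Icc_self
        · refine (ae_restrict_iff' measurableSet_Ioo).2 (Eventually.of_forall fun r hr => ?_)
          have := hr.1.le
          simp only [Pi.zero_apply]
          positivity
    _ ≤ _ := by
        refine setLIntegral_mono' measurableSet_Ioo fun r hr => ?_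
        gcongr
        exact hin r hr

end CauchyRiemannOnBall

end CauchyRiemann

/-! ### Uniform control of the metric and the almost complex structure in a chart. -/

section Chart

variable {E : Type*} [NormedAddCommGroup E] [NormedSpace ℝ E]
  {X : Type*} [TopologicalSpace X] [ChartedSpace E X] [IsManifold 𝓘(ℝ, E) ∞ X]

/-- The differential at `y` of the preferred chart at `x`. -/
noncomputable def chartDifferential (x y : X) : TangentSpace 𝓘(ℝ, E) y →L[ℝ] E :=
  mfderiv 𝓘(ℝ, E) 𝓘(ℝ, E) (extChartAt 𝓘(ℝ, E) x) y

theorem chartDifferential_eq {x y : X} (hy : y ∈ (chartAt E x).source) :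
    chartDifferential x y =
      (trivializationAt E (TangentSpace 𝓘(ℝ, E)) x).continuousLinearMapAt ℝ y := by
  have : IsManifold 𝓘(ℝ, E) 1 X := IsManifold.of_le (n := ∞) (by norm_cast)
  exact (TangentBundle.continuousLinearMapAt_trivializationAt hy).symm

/-- For the continuous bundle metric `g`, the tangent trivialization at `x` and its inverse have
locally bounded operator norms. -/
theorem exists_metric_bounds (g : SmoothRiemannianMetric E X) (x : X) :
    ∃ m > 0, ∃ M > 0, ∀ᶠ y in 𝓝 x, ∀ w : TangentSpace 𝓘(ℝ, E) y,
      m * ‖chartDifferential x y w‖ ^ 2 ≤ g.inner y w w ∧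
        g.inner y w w ≤ M * ‖chartDifferential x y w‖ ^ 2 := by
  let : Bundle.RiemannianBundle (fun x : X => TangentSpace 𝓘(ℝ, E) x) := ⟨g.toRiemannianMetric⟩
  have : IsContinuousRiemannianBundle E (fun x : X => TangentSpace 𝓘(ℝ, E) x) :=
    ⟨g.inner, g.contMDiff.continuous, fun _ _ _ => rfl⟩
  obtain ⟨C, hC, h1⟩ := eventually_norm_trivializationAt_lt E
    (fun x : X => TangentSpace 𝓘(ℝ, E) x) x
  obtain ⟨C', hC', h2⟩ := eventually_norm_symmL_trivializationAt_lt E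
    (fun x : X => TangentSpace 𝓘(ℝ, E) x) x
  refine ⟨(C ^ 2)⁻¹, by positivity, C' ^ 2, by positivity, ?_⟩
  filter_upwards [h1, h2, (chartAt E x).open_source.mem_nhds (mem_chart_source E x)]
    with y hy1 hy2 hy w
  have hg : g.inner y w w = ‖w‖ ^ 2 := real_inner_self_eq_norm_sq w
  rw [hg, chartDifferential_eq hy]
  constructor
  · rw [inv_mul_le_iff₀ (by positivity), ← mul_pow]
    gcongr
    refine (ContinuousLinearMap.le_opNorm _ _).trans ?_
    gcongr
  · rw [← mul_pow]
    gcongr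
    have hb : y ∈ (trivializationAt E (TangentSpace 𝓘(ℝ, E)) x).baseSet := by simpa using hy
    have h3 := ((trivializationAt E (TangentSpace 𝓘(ℝ, E)) x).symmL ℝ y).le_opNorm
      ((trivializationAt E (TangentSpace 𝓘(ℝ, E)) x).continuousLinearMapAt ℝ y w)
    rw [Bundle.Trivialization.symmL_continuousLinearMapAt _ hb] at h3
    refine h3.trans ?_
    gcongr

/-- The almost complex structure in the preferred chart at `x`. -/
noncomputable def chartComplexStructure (J : AlmostComplexStructure E X) (x y : X) : E →L[ℝ] E :=
  ContinuousLinearMap.inCoordinates E (fun y : X => TangentSpace 𝓘(ℝ, E) y) E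
    (fun y : X => TangentSpace 𝓘(ℝ, E) y) x y x y (J.toFun y)

theorem chartDifferential_apply (J : AlmostComplexStructure E X) {x y : X}
    (hy : y ∈ (chartAt E x).source) (w : TangentSpace 𝓘(ℝ, E) y) :
    chartDifferential x y (J.toFun y w) =
      chartComplexStructure J x y (chartDifferential x y w) := by
  have hb : y ∈ (trivializationAt E (TangentSpace 𝓘(ℝ, E)) x).baseSet := by simpa using hy
  rw [chartDifferential_eq hy]
  simp only [chartComplexStructure, ContinuousLinearMap.inCoordinates,
    ContinuousLinearMap.comp_apply]
  rw [Bundle.Trivialization.symmL_continuousLinearMapAt _ hb]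

theorem chartComplexStructure_apply_apply (J : AlmostComplexStructure E X) {x y : X}
    (hy : y ∈ (chartAt E x).source) (a : E) :
    chartComplexStructure J x y (chartComplexStructure J x y a) = -a := by
  have hb : y ∈ (trivializationAt E (TangentSpace 𝓘(ℝ, E)) x).baseSet := by simpa using hy
  obtain ⟨w, rfl⟩ : ∃ w, chartDifferential x y w = a :=
    ⟨(trivializationAt E (TangentSpace 𝓘(ℝ, E)) x).symmL ℝ y a, by
      rw [chartDifferential_eq hy, Bundle.Trivialization.continuousLinearMapAt_symmL _ hb]⟩
  rw [← chartDifferential_apply J hy, ← chartDifferential_apply J hy, J.apply_apply, map_neg]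

/-- In coordinates `J` is a smooth operator-valued function, and a `C^1` function is Lipschitz near
each point. -/
theorem exists_lipschitz_chartComplexStructure (J : AlmostComplexStructure E X) (x : X) :
    ∃ L : ℝ, 0 ≤ L ∧ ∃ N ∈ 𝓝 x, ∀ y ∈ N, ∀ y' ∈ N,
      ‖chartComplexStructure J x y - chartComplexStructure J x y'‖ ≤
        L * ‖extChartAt 𝓘(ℝ, E) x y - extChartAt 𝓘(ℝ, E) x y'‖ := by
  have h1 : ContMDiffAt 𝓘(ℝ, E) 𝓘(ℝ, E →L[ℝ] E) ∞ (chartComplexStructure J x) x :=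
    ((contMDiffAt_hom_bundle _).1 (J.contMDiff x)).2
  have h2 := (contMDiffAt_iff.1 h1).2
  simp only [mfld_simps] at h2
  obtain ⟨L, t, ht, hL⟩ := ((h2.contDiffAt univ_mem).of_le
    (m := 1) (by norm_cast)).exists_lipschitzOnWith
  refine ⟨L, L.2, (chartAt E x).source ∩ extChartAt 𝓘(ℝ, E) x ⁻¹' t, inter_mem
    ((chartAt E x).open_source.mem_nhds (mem_chart_source E x))
    ((continuousAt_extChartAt x).preimage_mem_nhds (by simpa using ht)), ?_⟩
  rintro y ⟨hy, hyt⟩ y' ⟨hy', hyt'⟩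
  have h3 := hL.dist_le_mul _ hyt _ hyt'
  simpa [dist_eq_norm, hy, hy', chartAt_self_eq] using h3

/-- The preferred chart at `x` controls the almost complex structure and the metric over the ball
of radius `ρ`. -/
structure ControlledChart (J : AlmostComplexStructure E X) (g : SmoothRiemannianMetric E X) (x : X)
    (ρ m M L k : ℝ) : Prop where
  radius_pos : 0 < ρ
  lower_pos : 0 < m
  upper_pos : 0 < M
  lipschitz_nonneg : 0 ≤ L
  closedBall_subset : Metric.closedBall (extChartAt 𝓘(ℝ, E) x x) ρ ⊆ (extChartAt 𝓘(ℝ, E) x).target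
  metric_bounds : ∀ y ∈ (chartAt E x).source,
    extChartAt 𝓘(ℝ, E) x y ∈ Metric.ball (extChartAt 𝓘(ℝ, E) x x) ρ →
      ∀ w : TangentSpace 𝓘(ℝ, E) y,
      m * ‖chartDifferential x y w‖ ^ 2 ≤ g.inner y w w ∧
        g.inner y w w ≤ M * ‖chartDifferential x y w‖ ^ 2
  lipschitz : ∀ y ∈ (chartAt E x).source,
    extChartAt 𝓘(ℝ, E) x y ∈ Metric.ball (extChartAt 𝓘(ℝ, E) x x) ρ →
    ∀ y' ∈ (chartAt E x).source,
    extChartAt 𝓘(ℝ, E) x y' ∈ Metric.ball (extChartAt 𝓘(ℝ, E) x x) ρ →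
      ‖chartComplexStructure J x y - chartComplexStructure J x y'‖ ≤
        L * ‖extChartAt 𝓘(ℝ, E) x y - extChartAt 𝓘(ℝ, E) x y'‖
  norm_le : ∀ y ∈ (chartAt E x).source,
    extChartAt 𝓘(ℝ, E) x y ∈ Metric.ball (extChartAt 𝓘(ℝ, E) x x) ρ →
      ‖chartComplexStructure J x y‖ ≤ k

theorem exists_controlledChart (J : AlmostComplexStructure E X) (g : SmoothRiemannianMetric E X)
    (x : X) : ∃ ρ m M L k : ℝ, ControlledChart J g x ρ m M L k := by
  obtain ⟨m, hm, M, hM, hmM⟩ := exists_metric_bounds g x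
  obtain ⟨L, hL0, N, hN, hL⟩ := exists_lipschitz_chartComplexStructure J x
  set φ := extChartAt 𝓘(ℝ, E) x with hφ
  have hS := inter_mem hmM hN
  have hsymm : φ.symm ⁻¹' ({y | ∀ w : TangentSpace 𝓘(ℝ, E) y,
      m * ‖chartDifferential x y w‖ ^ 2 ≤ g.inner y w w ∧
        g.inner y w w ≤ M * ‖chartDifferential x y w‖ ^ 2} ∩ N) ∩ φ.target ∈ 𝓝 (φ x) := by
    refine inter_mem ((continuousAt_extChartAt_symm x).preimage_mem_nhds ?_)
      (extChartAt_target_mem_nhds x)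
    rwa [extChartAt_to_inv]
  obtain ⟨ρ, hρ, hsub⟩ := Metric.nhds_basis_closedBall.mem_iff.1 hsymm
  have hkey : ∀ y ∈ (chartAt E x).source, φ y ∈ Metric.ball (φ x) ρ →
      y ∈ {y | ∀ w : TangentSpace 𝓘(ℝ, E) y,
      m * ‖chartDifferential x y w‖ ^ 2 ≤ g.inner y w w ∧
        g.inner y w w ≤ M * ‖chartDifferential x y w‖ ^ 2} ∩ N := by
    intro y hy hyb
    have h1 := (hsub (Metric.ball_subset_closedBall hyb)).1
    rwa [mem_preimage, φ.left_inv (by rwa [hφ, extChartAt_source])] at h1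
  -- The norm bound `k` is the value at `x` plus the Lipschitz variation over radius `ρ`.
  refine ⟨ρ, m, M, L, ‖chartComplexStructure J x x‖ + L * ρ, hρ, hm, hM, hL0,
    fun z hz => (hsub hz).2, fun y hy hyb => (hkey y hy hyb).1,
    fun y hy hyb y' hy' hyb' => hL y (hkey y hy hyb).2 y' (hkey y' hy' hyb').2, ?_⟩
  intro y hy hyb
  have h1 := hL y (hkey y hy hyb).2 x (mem_of_mem_nhds hN)
  have h2 := norm_le_norm_add_norm_sub' (chartComplexStructure J x y) (chartComplexStructure J x x)
  have h3 : ‖φ y - φ x‖ ≤ ρ := by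
    rw [← dist_eq_norm]; exact (Metric.mem_ball.1 hyb).le
  have h4 : L * ‖φ y - φ x‖ ≤ L * ρ := by gcongr
  linarith

end Chart

/-! ### Maps from the plane: energy density and confinement to a chart. -/

section Plane

variable {E : Type*} [NormedAddCommGroup E] [NormedSpace ℝ E]
  {X : Type*} [TopologicalSpace X] [ChartedSpace E X] [IsManifold 𝓘(ℝ, E) ∞ X]

/-- A `J`-holomorphic plane. -/
structure IsJHolomorphicPlane (J : AlmostComplexStructure E X) (f : ℂ → X) : Prop where
  contMDiff : ContMDiff 𝓘(ℝ, ℂ) 𝓘(ℝ, E) ∞ f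
  mfderiv_I_mul : ∀ z w : ℂ, mfderiv 𝓘(ℝ, ℂ) 𝓘(ℝ, E) f z (Complex.I * w : ℂ) =
    J.toFun (f z) (mfderiv 𝓘(ℝ, ℂ) 𝓘(ℝ, E) f z w)

/-- The energy density of a map from the plane. -/
noncomputable def planeEnergyDensity (g : SmoothRiemannianMetric E X) (f : ℂ → X) (z : ℂ) : ℝ :=
  (g.inner (f z) (mfderiv 𝓘(ℝ, ℂ) 𝓘(ℝ, E) f z (1 : ℂ)) (mfderiv 𝓘(ℝ, ℂ) 𝓘(ℝ, E) f z (1 : ℂ)) +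
    g.inner (f z) (mfderiv 𝓘(ℝ, ℂ) 𝓘(ℝ, E) f z Complex.I)
      (mfderiv 𝓘(ℝ, ℂ) 𝓘(ℝ, E) f z Complex.I)) / 2

theorem metric_nonneg (g : SmoothRiemannianMetric E X) (y : X) (w : TangentSpace 𝓘(ℝ, E) y) :
    0 ≤ g.inner y w w := by
  rcases eq_or_ne w 0 with rfl | hw
  · simp
  · exact (g.pos y w hw).le

theorem planeEnergyDensity_nonneg (g : SmoothRiemannianMetric E X) (f : ℂ → X) (z : ℂ) :
    0 ≤ planeEnergyDensity g f z :=
  div_nonneg (add_nonneg (metric_nonneg g _ _) (metric_nonneg g _ _)) zero_le_two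

theorem continuous_planeEnergyDensity (g : SmoothRiemannianMetric E X) {f : ℂ → X}
    (hf : ContMDiff 𝓘(ℝ, ℂ) 𝓘(ℝ, E) ∞ f) : Continuous (planeEnergyDensity g f) := by
  let : Bundle.RiemannianBundle (fun x : X => TangentSpace 𝓘(ℝ, E) x) := ⟨g.toRiemannianMetric⟩
  have : IsContinuousRiemannianBundle E (fun x : X => TangentSpace 𝓘(ℝ, E) x) :=
    ⟨g.inner, g.contMDiff.continuous, fun _ _ _ => rfl⟩
  have : IsManifold 𝓘(ℝ, E) 1 X := IsManifold.of_le (n := ∞) (by norm_cast)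
  have hs : ∀ w : ℂ, Continuous fun z : ℂ => (⟨f z, mfderiv 𝓘(ℝ, ℂ) 𝓘(ℝ, E) f z w⟩ :
      Bundle.TotalSpace E (fun x : X => TangentSpace 𝓘(ℝ, E) x)) := fun w => by
    have h1 : Continuous (tangentMap 𝓘(ℝ, ℂ) 𝓘(ℝ, E) f) :=
      hf.continuous_tangentMap (by simp)
    have h2 : Continuous fun z : ℂ => (tangentBundleModelSpaceHomeomorph 𝓘(ℝ, ℂ)).symm (z, w) :=
      (tangentBundleModelSpaceHomeomorph 𝓘(ℝ, ℂ)).symm.continuous.comp (by fun_prop)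
    exact h1.comp h2
  have hi : ∀ w : ℂ, Continuous fun z : ℂ => g.inner (f z) (mfderiv 𝓘(ℝ, ℂ) 𝓘(ℝ, E) f z w)
      (mfderiv 𝓘(ℝ, ℂ) 𝓘(ℝ, E) f z w) := fun w => (hs w).inner_bundle (hs w)
  exact ((hi 1).add (hi Complex.I)).div_const 2

theorem hasFDerivAt_chart_comp {f : ℂ → X} (hf : ContMDiff 𝓘(ℝ, ℂ) 𝓘(ℝ, E) ∞ f) {x : X} {z : ℂ}
    (hz : f z ∈ (chartAt E x).source) :
    HasFDerivAt (extChartAt 𝓘(ℝ, E) x ∘ f)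
      ((chartDifferential x (f z)).comp (mfderiv 𝓘(ℝ, ℂ) 𝓘(ℝ, E) f z) : ℂ →L[ℝ] E) z := by
  have : IsManifold 𝓘(ℝ, E) 1 X := IsManifold.of_le (n := ∞) (by norm_cast)
  have h1 : HasMFDerivAt 𝓘(ℝ, ℂ) 𝓘(ℝ, E) f z (mfderiv 𝓘(ℝ, ℂ) 𝓘(ℝ, E) f z) :=
    (hf.mdifferentiableAt (by simp)).hasMFDerivAt
  have h2 : HasMFDerivAt 𝓘(ℝ, E) 𝓘(ℝ, E) (extChartAt 𝓘(ℝ, E) x) (f z)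
      (chartDifferential x (f z)) := (mdifferentiableAt_extChartAt hz).hasMFDerivAt
  exact (h2.comp z h1).hasFDerivAt

theorem fderiv_chart_comp_apply {f : ℂ → X} (hf : ContMDiff 𝓘(ℝ, ℂ) 𝓘(ℝ, E) ∞ f) {x : X} {z : ℂ}
    (hz : f z ∈ (chartAt E x).source) (w : ℂ) :
    fderiv ℝ (extChartAt 𝓘(ℝ, E) x ∘ f) z w =
      chartDifferential x (f z) (mfderiv 𝓘(ℝ, ℂ) 𝓘(ℝ, E) f z w) := by
  rw [(hasFDerivAt_chart_comp hf hz).fderiv]; rfl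

theorem continuousAt_fderiv_chart_comp {f : ℂ → X} (hf : ContMDiff 𝓘(ℝ, ℂ) 𝓘(ℝ, E) ∞ f) {x : X}
    {z : ℂ} (hz : f z ∈ (chartAt E x).source) :
    ContinuousAt (fderiv ℝ (extChartAt 𝓘(ℝ, E) x ∘ f)) z := by
  have h1 : ContMDiffAt 𝓘(ℝ, ℂ) 𝓘(ℝ, E) ∞ (extChartAt 𝓘(ℝ, E) x ∘ f) z :=
    (contMDiffAt_extChartAt' hz).comp z (hf z)
  exact h1.contDiffAt.continuousAt_fderiv (by simp)

theorem norm_sq_le_of_complex_domain (D : ℂ →L[ℝ] E) :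
    ‖D‖ ^ 2 ≤ ‖D 1‖ ^ 2 + ‖D Complex.I‖ ^ 2 := by
  have h : ‖D‖ ≤ √(‖D 1‖ ^ 2 + ‖D Complex.I‖ ^ 2) := by
    refine D.opNorm_le_bound (Real.sqrt_nonneg _) fun w => ?_
    have h1 : D w = w.re • D 1 + w.im • D Complex.I := by
      rw [← map_smul, ← map_smul, ← map_add]; congr 1; simp
    have h2 : ‖D w‖ ≤ |w.re| * ‖D 1‖ + |w.im| * ‖D Complex.I‖ := by
      rw [h1]
      refine (norm_add_le _ _).trans (le_of_eq ?_)
      rw [norm_smul, norm_smul, Real.norm_eq_abs, Real.norm_eq_abs]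
    refine h2.trans ?_
    rw [Complex.norm_eq_sqrt_sq_add_sq, ← Real.sqrt_mul (by positivity)]
    refine Real.le_sqrt_of_sq_le ?_
    nlinarith [sq_nonneg (|w.re| * ‖D Complex.I‖ - |w.im| * ‖D 1‖), sq_abs w.re, sq_abs w.im]
  calc ‖D‖ ^ 2 ≤ √(‖D 1‖ ^ 2 + ‖D Complex.I‖ ^ 2) ^ 2 := by gcongr
    _ = _ := Real.sq_sqrt (by positivity)

/-- A map with small derivative stays in the domain of a chart. -/
theorem mem_chart_of_norm_fderiv_le [T2Space X] [FiniteDimensional ℝ E] {f : ℂ → X}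
    (hf : ContMDiff 𝓘(ℝ, ℂ) 𝓘(ℝ, E) ∞ f) {x : X} {c : ℂ} {ρ R Λ : ℝ} (hρ : 0 < ρ)
    (hsub : Metric.closedBall (extChartAt 𝓘(ℝ, E) x x) ρ ⊆ (extChartAt 𝓘(ℝ, E) x).target)
    (hc : f c ∈ (chartAt E x).source)
    (hcb : extChartAt 𝓘(ℝ, E) x (f c) ∈ Metric.ball (extChartAt 𝓘(ℝ, E) x x) (ρ / 2))
    (hΛ : 0 ≤ Λ) (hR : Λ * R ≤ ρ / 2)
    (hD : ∀ z ∈ Metric.ball c R, f z ∈ (chartAt E x).source →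
      extChartAt 𝓘(ℝ, E) x (f z) ∈ Metric.ball (extChartAt 𝓘(ℝ, E) x x) ρ →
      ‖fderiv ℝ (extChartAt 𝓘(ℝ, E) x ∘ f) z‖ ≤ Λ) :
    ∀ z ∈ Metric.ball c R, f z ∈ (chartAt E x).source ∧
      extChartAt 𝓘(ℝ, E) x (f z) ∈ Metric.ball (extChartAt 𝓘(ℝ, E) x x) ρ := by
  intro z hz
  set φ := extChartAt 𝓘(ℝ, E) x with hφ
  have hsrc : φ.source = (chartAt E x).source := extChartAt_source _ x
  set V : Set X := (chartAt E x).source ∩ φ ⁻¹' Metric.ball (φ x) ρ with hV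
  have hVo : IsOpen V := isOpen_extChartAt_preimage x Metric.isOpen_ball
  have hKsub : Metric.closedBall (φ (f c)) (ρ / 2) ⊆ Metric.ball (φ x) ρ := by
    intro a ha
    rw [Metric.mem_ball] at hcb ⊢
    rw [Metric.mem_closedBall] at ha
    linarith [dist_triangle a (φ (f c)) (φ x)]
  have hKt : Metric.closedBall (φ (f c)) (ρ / 2) ⊆ φ.target :=
    (hKsub.trans Metric.ball_subset_closedBall).trans hsub
  -- The coordinate `φ ∘ f` is meaningless once `f` leaves the chart, so a bound on it alone does
  -- not confine `f`. The image `K` of a compact ball is closed in the Hausdorff space `X` and lies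
  -- in the open set `V`, so a path in `K` cannot exit `V` in the limit.
  set K : Set X := φ.symm '' Metric.closedBall (φ (f c)) (ρ / 2) with hK
  have hKc : IsClosed K := (((isCompact_closedBall (φ (f c)) (ρ / 2)).image_of_continuousOn
    ((continuousOn_extChartAt_symm x).mono hKt))).isClosed
  have hKV : K ⊆ V := by
    rintro _ ⟨a, ha, rfl⟩
    refine ⟨hsrc ▸ φ.map_target (hKt ha), ?_⟩
    rw [mem_preimage, φ.right_inv (hKt ha)]
    exact hKsub ha
  set γ : ℝ → ℂ := fun t => c + t • (z - c) with hγ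
  have hγc : Continuous γ := by rw [hγ]; fun_prop
  have hγ0 : γ 0 = c := by simp [hγ]
  have hγ1 : γ 1 = z := by simp [hγ]
  have hzc : ‖z - c‖ < R := by rwa [← dist_eq_norm]
  have hγb : ∀ t ∈ Icc (0 : ℝ) 1, γ t ∈ Metric.ball c R := by
    intro t ht
    rw [Metric.mem_ball, dist_eq_norm, hγ]
    simp only [add_sub_cancel_left, norm_smul, Real.norm_of_nonneg ht.1]
    exact (mul_le_of_le_one_left (norm_nonneg _) ht.2).trans_lt hzc
  have hγd : ∀ t, HasDerivAt γ (z - c) t := fun t => by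
    simpa only [id, one_smul] using ((hasDerivAt_id t).smul_const (z - c)).const_add c
  have hfγ : Continuous (f ∘ γ) := hf.continuous.comp hγc
  suffices h : f (γ 1) ∈ V by rw [hγ1] at h; exact h
  by_contra hcon
  -- `T` is the first exit time from `V` along the segment from `c` to `z`. Before `T` the
  -- derivative bound keeps `f` in `K`; closedness then puts the exit point in `K ⊆ V`, a
  -- contradiction.
  obtain ⟨T, ⟨hTI, hTV⟩, hTmin⟩ :=
    (isCompact_Icc.inter_right (hVo.isClosed_compl.preimage hfγ)).exists_isLeast
      (⟨1, ⟨zero_le_one, le_rfl⟩, hcon⟩ : (Icc (0 : ℝ) 1 ∩ (f ∘ γ) ⁻¹' Vᶜ).Nonempty)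
  have hbefore : ∀ t ∈ Ico 0 T, f (γ t) ∈ V := by
    intro t ht
    by_contra h
    exact absurd (hTmin ⟨⟨ht.1, (ht.2.le).trans hTI.2⟩, h⟩) (not_le.2 ht.2)
  have hinK : ∀ t ∈ Ico 0 T, f (γ t) ∈ K := by
    intro t ht
    have h1 := norm_image_sub_le_of_norm_deriv_le_segment' (a := 0) (b := t)
      (f := (φ ∘ f) ∘ γ) (f' := fun s => fderiv ℝ (φ ∘ f) (γ s) (z - c)) (C := Λ * R)
      (fun s hs => (((hasFDerivAt_chart_comp hf (hbefore s ⟨hs.1, hs.2.trans_lt ht.2⟩).1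
        ).differentiableAt.hasFDerivAt).comp_hasDerivAt s (hγd s)).hasDerivWithinAt)
      (fun s hs => by
        have hs' := hbefore s ⟨hs.1, hs.2.trans ht.2⟩
        refine (ContinuousLinearMap.le_opNorm _ _).trans ?_
        have h2 := hD (γ s) (hγb s ⟨hs.1, ((hs.2.trans ht.2).le).trans hTI.2⟩) hs'.1 hs'.2
        gcongr) t ⟨ht.1, le_rfl⟩
    refine ⟨φ (f (γ t)), ?_, φ.left_inv (hsrc ▸ (hbefore t ht).1)⟩
    rw [Metric.mem_closedBall, dist_eq_norm]
    simp only [Function.comp_apply, hγ0, sub_zero] at h1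
    have ht1 : t ≤ 1 := (ht.2.le).trans hTI.2
    have hΛR : 0 ≤ Λ * R := mul_nonneg hΛ ((norm_nonneg _).trans hzc.le)
    exact h1.trans ((mul_le_of_le_one_right hΛR ht1).trans hR)
  have hT0 : 0 ≠ T := by
    rintro rfl
    refine hTV ⟨?_, ?_⟩
    · simpa only [Function.comp_apply, hγ0] using hc
    · rw [mem_preimage, Function.comp_apply, hγ0]
      exact Metric.ball_subset_ball (by linarith) hcb
  have hcl : closure (Ico 0 T) ⊆ (f ∘ γ) ⁻¹' K :=
    (hKc.preimage hfγ).closure_subset_iff.2 hinK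
  rw [closure_Ico hT0] at hcl
  exact hTV (hKV (hcl ⟨hTI.1, le_rfl⟩))

theorem mfderiv_eq_zero_of_planeEnergyDensity_eq_zero (g : SmoothRiemannianMetric E X) {f : ℂ → X}
    {z : ℂ} (h : planeEnergyDensity g f z = 0) : mfderiv 𝓘(ℝ, ℂ) 𝓘(ℝ, E) f z = 0 := by
  have h0 : ∀ w : TangentSpace 𝓘(ℝ, E) (f z), g.inner (f z) w w = 0 → w = 0 := fun w hw => by
    by_contra hne
    exact (g.pos (f z) w hne).ne' hw
  unfold planeEnergyDensity at h
  have h1 := metric_nonneg g (f z) (mfderiv 𝓘(ℝ, ℂ) 𝓘(ℝ, E) f z (1 : ℂ))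
  have h2 := metric_nonneg g (f z) (mfderiv 𝓘(ℝ, ℂ) 𝓘(ℝ, E) f z Complex.I)
  have h3 := h0 _ (by linarith : g.inner (f z) (mfderiv 𝓘(ℝ, ℂ) 𝓘(ℝ, E) f z (1 : ℂ)) _ = 0)
  have h4 := h0 _ (by linarith : g.inner (f z) (mfderiv 𝓘(ℝ, ℂ) 𝓘(ℝ, E) f z Complex.I) _ = 0)
  refine ContinuousLinearMap.ext fun w : ℂ => ?_
  have hw : w = w.re • (1 : ℂ) + w.im • Complex.I := by simp
  have h5 : mfderiv 𝓘(ℝ, ℂ) 𝓘(ℝ, E) f z w =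
      w.re • mfderiv 𝓘(ℝ, ℂ) 𝓘(ℝ, E) f z (1 : ℂ) +
        w.im • mfderiv 𝓘(ℝ, ℂ) 𝓘(ℝ, E) f z Complex.I := by
    conv_lhs => rw [hw]
    exact (map_add _ _ _).trans (congrArg₂ _ (map_smul _ _ _) (map_smul _ _ _))
  rw [h5, h3, h4, smul_zero, smul_zero, add_zero]
  rfl

/-- Vanishing density kills the differential, so `f` is locally constant in charts, and the plane is
connected. -/
theorem eq_of_planeEnergyDensity_eq_zero (g : SmoothRiemannianMetric E X) {f : ℂ → X}
    (hf : ContMDiff 𝓘(ℝ, ℂ) 𝓘(ℝ, E) ∞ f) (h : ∀ z, planeEnergyDensity g f z = 0) (z w : ℂ) :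
    f z = f w := by
  have hloc : IsLocallyConstant f := by
    rw [IsLocallyConstant.iff_eventually_eq]
    intro z
    have hsrc : f ⁻¹' (chartAt E (f z)).source ∈ 𝓝 z :=
      hf.continuous.continuousAt.preimage_mem_nhds
        ((chartAt E (f z)).open_source.mem_nhds (mem_chart_source E (f z)))
    obtain ⟨r, hr, hsub⟩ := Metric.mem_nhds_iff.1 hsrc
    have hd : ∀ y ∈ Metric.ball z r,
        HasFDerivAt (extChartAt 𝓘(ℝ, E) (f z) ∘ f) (0 : ℂ →L[ℝ] E) y := fun y hy => by
      have h1 := hasFDerivAt_chart_comp hf (hsub hy)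
      have h2 := mfderiv_eq_zero_of_planeEnergyDensity_eq_zero g (h y)
      refine h1.congr_fderiv ?_
      rw [h2]
      exact ContinuousLinearMap.comp_zero _
    filter_upwards [Metric.ball_mem_nhds z hr] with y hy
    have h3 := (convex_ball z r).norm_image_sub_le_of_norm_hasFDerivWithin_le (C := 0)
      (fun a ha => (hd a ha).hasFDerivWithinAt) (fun _ _ => by simp) (Metric.mem_ball_self hr) hy
    rw [zero_mul, norm_le_zero_iff, sub_eq_zero] at h3
    exact (extChartAt 𝓘(ℝ, E) (f z)).injOn (by simpa using hsub hy) (by simp) h3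
  exact hloc.apply_eq_of_preconnectedSpace z w

end Plane

/-! ### Local energy bounds, compactness and rescaling. -/

section Quantization

variable {E : Type*} [NormedAddCommGroup E] [NormedSpace ℝ E]
  {X : Type*} [TopologicalSpace X] [ChartedSpace E X] [IsManifold 𝓘(ℝ, E) ∞ X]

/-- A lower bound `h` for the energy of a `J`-holomorphic plane `f` with `f c = y`, when the energy
density near `c` is controlled by its value at `c`, on a disk which is large after rescaling. -/
def EnergyLowerBoundAt (J : AlmostComplexStructure E X) (g : SmoothRiemannianMetric E X) (h S : ℝ)
    (y : X) : Prop :=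
  ∀ f : ℂ → X, IsJHolomorphicPlane J f → ∀ (c : ℂ) (σ Λ : ℝ), f c = y → 0 < Λ →
    planeEnergyDensity g f c = Λ ^ 2 →
    (∀ z ∈ Metric.ball c σ, planeEnergyDensity g f z ≤ 4 * Λ ^ 2) → S ≤ σ * Λ →
      ENNReal.ofReal h ≤ ∫⁻ z, ENNReal.ofReal (planeEnergyDensity g f z)

namespace ControlledChart

variable {J : AlmostComplexStructure E X} {g : SmoothRiemannianMetric E X} {x : X} {ρ m M L k : ℝ}

theorem le_planeEnergyDensity (hc : ControlledChart J g x ρ m M L k) {f : ℂ → X}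
    (hf : ContMDiff 𝓘(ℝ, ℂ) 𝓘(ℝ, E) ∞ f) {z : ℂ} (hz : f z ∈ (chartAt E x).source)
    (hzb : extChartAt 𝓘(ℝ, E) x (f z) ∈ Metric.ball (extChartAt 𝓘(ℝ, E) x x) ρ) :
    m / 2 * ‖fderiv ℝ (extChartAt 𝓘(ℝ, E) x ∘ f) z‖ ^ 2 ≤ planeEnergyDensity g f z := by
  have h1 := (hc.metric_bounds _ hz hzb (mfderiv 𝓘(ℝ, ℂ) 𝓘(ℝ, E) f z (1 : ℂ))).1
  have h2 := (hc.metric_bounds _ hz hzb (mfderiv 𝓘(ℝ, ℂ) 𝓘(ℝ, E) f z Complex.I)).1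
  rw [← fderiv_chart_comp_apply hf hz] at h1 h2
  have h3 := norm_sq_le_of_complex_domain (fderiv ℝ (extChartAt 𝓘(ℝ, E) x ∘ f) z)
  have h4 := mul_le_mul_of_nonneg_left h3 hc.lower_pos.le
  unfold planeEnergyDensity
  linarith

theorem fderiv_I_mul {f : ℂ → X} (hf : IsJHolomorphicPlane J f) {z : ℂ}
    (hz : f z ∈ (chartAt E x).source) (w : ℂ) :
    fderiv ℝ (extChartAt 𝓘(ℝ, E) x ∘ f) z (Complex.I * w) =
      chartComplexStructure J x (f z) (fderiv ℝ (extChartAt 𝓘(ℝ, E) x ∘ f) z w) := by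
  rw [fderiv_chart_comp_apply hf.contMDiff hz, fderiv_chart_comp_apply hf.contMDiff hz,
    hf.mfderiv_I_mul, chartDifferential_apply J hz]

/-- The equation gives `‖D i‖ ≤ k * ‖D 1‖`, so the density is controlled by `D 1` alone, the
quantity in the mean value inequality. -/
theorem planeEnergyDensity_le (hc : ControlledChart J g x ρ m M L k) {f : ℂ → X}
    (hf : IsJHolomorphicPlane J f) {z : ℂ} (hz : f z ∈ (chartAt E x).source)
    (hzb : extChartAt 𝓘(ℝ, E) x (f z) ∈ Metric.ball (extChartAt 𝓘(ℝ, E) x x) ρ) :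
    planeEnergyDensity g f z ≤
      M * (1 + k) ^ 2 * ‖fderiv ℝ (extChartAt 𝓘(ℝ, E) x ∘ f) z 1‖ ^ 2 := by
  have h1 := (hc.metric_bounds _ hz hzb (mfderiv 𝓘(ℝ, ℂ) 𝓘(ℝ, E) f z (1 : ℂ))).2
  have h2 := (hc.metric_bounds _ hz hzb (mfderiv 𝓘(ℝ, ℂ) 𝓘(ℝ, E) f z Complex.I)).2
  rw [← fderiv_chart_comp_apply hf.contMDiff hz] at h1 h2
  have hI := fderiv_I_mul hf hz 1
  rw [mul_one] at hI
  set D := fderiv ℝ (extChartAt 𝓘(ℝ, E) x ∘ f) z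
  have hk : ‖chartComplexStructure J x (f z)‖ ≤ k := hc.norm_le _ hz hzb
  have hk0 : 0 ≤ k := (norm_nonneg _).trans hk
  have h3 : ‖D Complex.I‖ ≤ k * ‖D 1‖ := by
    rw [hI]
    refine (ContinuousLinearMap.le_opNorm _ _).trans ?_
    gcongr
  have h4 : ‖D Complex.I‖ ^ 2 ≤ (k * ‖D 1‖) ^ 2 := by gcongr
  have h5 := mul_le_mul_of_nonneg_left h4 hc.upper_pos.le
  have h6 : 0 ≤ M * ‖D 1‖ ^ 2 := mul_nonneg hc.upper_pos.le (sq_nonneg _)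
  have h7 : 0 ≤ M * ‖D 1‖ ^ 2 * k := mul_nonneg h6 hk0
  have h8 : 0 ≤ M * ‖D 1‖ ^ 2 * k ^ 2 := mul_nonneg h6 (sq_nonneg _)
  unfold planeEnergyDensity
  nlinarith

theorem cauchyRiemannOnBall (hc : ControlledChart J g x ρ m M L k) {f : ℂ → X}
    (hf : IsJHolomorphicPlane J f) {c : ℂ} {R Λ : ℝ} (hR : 0 < R)
    (hmem : ∀ z ∈ Metric.ball c R, f z ∈ (chartAt E x).source ∧
      extChartAt 𝓘(ℝ, E) x (f z) ∈ Metric.ball (extChartAt 𝓘(ℝ, E) x x) ρ)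
    (hΛ : ∀ z ∈ Metric.ball c R, ‖fderiv ℝ (extChartAt 𝓘(ℝ, E) x ∘ f) z‖ ≤ Λ) :
    CauchyRiemannOnBall (extChartAt 𝓘(ℝ, E) x ∘ f) (fderiv ℝ (extChartAt 𝓘(ℝ, E) x ∘ f))
      (fun z => chartComplexStructure J x (f z)) (chartComplexStructure J x (f c)) c R L Λ where
  hasFDerivAt z hz :=
    (hasFDerivAt_chart_comp hf.contMDiff (hmem z hz).1).differentiableAt.hasFDerivAt
  continuousOn z hz :=
    (continuousAt_fderiv_chart_comp hf.contMDiff (hmem z hz).1).continuousWithinAt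
  cauchyRiemann z hz := fderiv_I_mul hf (hmem z hz).1
  sq_eq := chartComplexStructure_apply_apply J (hmem c (Metric.mem_ball_self hR)).1
  norm_sub_le z hz := hc.lipschitz _ (hmem z hz).1 (hmem z hz).2 _
    (hmem c (Metric.mem_ball_self hR)).1 (hmem c (Metric.mem_ball_self hR)).2
  norm_le := hΛ
  radius_pos := hR
  lipschitz_nonneg := hc.lipschitz_nonneg

theorem exists_energyLowerBoundAt [T2Space X] [FiniteDimensional ℝ E]
    (hc : ControlledChart J g x ρ m M L k) :
    ∃ h S : ℝ, 0 < h ∧ ∀ y ∈ (chartAt E x).source,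
      extChartAt 𝓘(ℝ, E) x y ∈ Metric.ball (extChartAt 𝓘(ℝ, E) x x) (ρ / 2) →
        EnergyLowerBoundAt J g h S y := by
  have : CompleteSpace E := FiniteDimensional.complete ℝ E
  have hρ := hc.radius_pos
  have hm := hc.lower_pos
  have hM := hc.upper_pos
  have hL := hc.lipschitz_nonneg
  have hk0 : 0 ≤ k := (norm_nonneg _).trans
    (hc.norm_le x (mem_chart_source E x) (Metric.mem_ball_self hρ))
  -- With `e c = Λ₀ ^ 2`, the bound `e ≤ 4 * Λ₀ ^ 2` becomes `‖D‖ ≤ a * Λ₀ = Λ`, while `b` gives `Λ₀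
  -- ≤ b * ‖D c 1‖`. Hence `α = 1 / (a * b)` satisfies `α * Λ ≤ ‖D c 1‖`.
  set a : ℝ := √(8 / m) with ha
  have ha0 : 0 < a := by positivity
  have ha2 : a ^ 2 = 8 / m := Real.sq_sqrt (by positivity)
  set b : ℝ := √M * (1 + k) with hb
  have hb0 : 0 < b := by positivity
  have hb2 : b ^ 2 = M * (1 + k) ^ 2 := by rw [hb, mul_pow, Real.sq_sqrt hM.le]
  set α : ℝ := 1 / (a * b) with hα
  have hα0 : 0 < α := by positivity
  set B : ℝ := 2 * Real.pi * ((1 + k) * (k * L)) with hB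
  have hB0 : 0 ≤ B := by positivity
  -- `δ` will be `Λ * R`. The first bound keeps `f` in the chart, the second absorbs the error term;
  -- the `+ 1` covers `B = 0`.
  set δ : ℝ := min (ρ / 2) (Real.pi * α / (2 * B + 1)) with hδ
  have hδ0 : 0 < δ := lt_min (by positivity) (by positivity)
  have hδB : 2 * B * δ ≤ Real.pi * α := by
    have h1 : δ ≤ Real.pi * α / (2 * B + 1) := min_le_right _ _
    rw [le_div_iff₀ (by positivity)] at h1
    linarith
  -- The threshold `δ / a` is what makes `R = δ / Λ ≤ σ`.
  refine ⟨m / 2 * (Real.pi * (α * δ / (2 * (1 + k))) ^ 2), δ / a, by positivity, ?_⟩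
  rintro _ hy hyb f hf c σ Λ₀ rfl hΛ₀ hec he hS
  set Λ : ℝ := a * Λ₀ with hΛ
  have hΛ0 : 0 < Λ := by positivity
  set R : ℝ := δ / Λ with hR
  have hR0 : 0 < R := by positivity
  have hΛR : Λ * R = δ := by rw [hR]; field_simp
  have hRσ : R ≤ σ := by
    rw [div_le_iff₀ ha0] at hS
    rw [hR, div_le_iff₀ hΛ0, hΛ]
    linarith
  have hD : ∀ z ∈ Metric.ball c R, f z ∈ (chartAt E x).source →
      extChartAt 𝓘(ℝ, E) x (f z) ∈ Metric.ball (extChartAt 𝓘(ℝ, E) x x) ρ →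
      ‖fderiv ℝ (extChartAt 𝓘(ℝ, E) x ∘ f) z‖ ≤ Λ := by
    intro z hz hzs hzb
    have h1 := hc.le_planeEnergyDensity hf.contMDiff hzs hzb
    have h2 := he z (Metric.ball_subset_ball hRσ hz)
    refine le_of_sq_le_sq ?_ hΛ0.le
    have h3 : Λ ^ 2 = (m / 2)⁻¹ * (4 * Λ₀ ^ 2) := by
      rw [hΛ, mul_pow, ha2]; field_simp; norm_num
    rw [h3, ← div_eq_inv_mul, le_div_iff₀ (by positivity)]
    linarith
  have hmem := mem_chart_of_norm_fderiv_le hf.contMDiff hρ hc.closedBall_subset hy hyb hΛ0.le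
    (hΛR.trans_le (min_le_left _ _)) hD
  have hcm := hmem c (Metric.mem_ball_self hR0)
  have hCR := hc.cauchyRiemannOnBall hf hR0 hmem fun z hz => hD z hz (hmem z hz).1 (hmem z hz).2
  have hJk : ‖chartComplexStructure J x (f c)‖ ≤ k := hc.norm_le _ hcm.1 hcm.2
  have hα1 : α * Λ ≤ ‖fderiv ℝ (extChartAt 𝓘(ℝ, E) x ∘ f) c 1‖ := by
    have h1 := hc.planeEnergyDensity_le hf hcm.1 hcm.2
    rw [hec, ← hb2, ← mul_pow] at h1
    have h2 := le_of_sq_le_sq h1 (by positivity)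
    have h3 : α * Λ = Λ₀ / b := by rw [hα, hΛ]; field_simp
    rw [h3, div_le_iff₀ hb0]
    linarith
  have herr : CauchyRiemannOnBall.errorConst (chartComplexStructure J x (f c)) L ≤ B := by
    unfold CauchyRiemannOnBall.errorConst
    rw [hB]
    gcongr
  have hmain := hCR.le_lintegral_norm_sq hα1 hα0.le (by
    calc 2 * CauchyRiemannOnBall.errorConst (chartComplexStructure J x (f c)) L * Λ * R
        = 2 * CauchyRiemannOnBall.errorConst (chartComplexStructure J x (f c)) L * (Λ * R) := by
          ring
      _ ≤ 2 * B * δ := by rw [hΛR]; gcongr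
      _ ≤ Real.pi * α := hδB)
  have hval : Real.pi * (α * δ / (2 * (1 + k))) ^ 2 ≤
      Real.pi * (α * Λ / (2 * (1 + ‖chartComplexStructure J x (f c)‖))) ^ 2 * R ^ 2 := by
    have h1 : α * Λ / (2 * (1 + ‖chartComplexStructure J x (f c)‖)) * R =
        α * δ / (2 * (1 + ‖chartComplexStructure J x (f c)‖)) := by
      rw [← hΛR]; ring
    rw [mul_assoc, ← mul_pow, h1]
    gcongr
  calc ENNReal.ofReal (m / 2 * (Real.pi * (α * δ / (2 * (1 + k))) ^ 2))
      ≤ ENNReal.ofReal (m / 2) * ∫⁻ z in Metric.ball c R,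
          ENNReal.ofReal (‖fderiv ℝ (extChartAt 𝓘(ℝ, E) x ∘ f) z‖ ^ 2) := by
        rw [ENNReal.ofReal_mul (by positivity)]
        gcongr
        exact (ENNReal.ofReal_le_ofReal hval).trans hmain
    _ = ∫⁻ z in Metric.ball c R,
          ENNReal.ofReal (m / 2 * ‖fderiv ℝ (extChartAt 𝓘(ℝ, E) x ∘ f) z‖ ^ 2) := by
        rw [← lintegral_const_mul' _ _ ENNReal.ofReal_ne_top]
        simp_rw [← ENNReal.ofReal_mul (by positivity : 0 ≤ m / 2)]
    _ ≤ ∫⁻ z in Metric.ball c R, ENNReal.ofReal (planeEnergyDensity g f z) :=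
        setLIntegral_mono' Metric.isOpen_ball.measurableSet fun z hz =>
          ENNReal.ofReal_le_ofReal
            (hc.le_planeEnergyDensity hf.contMDiff (hmem z hz).1 (hmem z hz).2)
    _ ≤ _ := setLIntegral_le_lintegral _ _

end ControlledChart

/-- Compactness induction on sets of centers: a union takes the smaller bound and the larger
threshold. -/
theorem exists_forall_energyLowerBoundAt [T2Space X] [CompactSpace X] [FiniteDimensional ℝ E]
    (J : AlmostComplexStructure E X) (g : SmoothRiemannianMetric E X) :
    ∃ h S : ℝ, 0 < h ∧ ∀ y, EnergyLowerBoundAt J g h S y := by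
  have key : ∃ h S : ℝ, 0 < h ∧ ∀ y ∈ (univ : Set X), EnergyLowerBoundAt J g h S y := by
    refine isCompact_univ.induction_on
      (p := fun s => ∃ h S : ℝ, 0 < h ∧ ∀ y ∈ s, EnergyLowerBoundAt J g h S y)
      ⟨1, 0, one_pos, fun y hy => hy.elim⟩ ?_ ?_ ?_
    · rintro s t hst ⟨h, S, hh, H⟩
      exact ⟨h, S, hh, fun y hy => H y (hst hy)⟩
    · rintro s t ⟨h, S, hh, H⟩ ⟨h', S', hh', H'⟩
      refine ⟨min h h', max S S', lt_min hh hh', ?_⟩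
      rintro y (hy | hy) f hf c σ Λ hfc hΛ hec he hS
      · exact (ENNReal.ofReal_le_ofReal (min_le_left _ _)).trans
          (H y hy f hf c σ Λ hfc hΛ hec he ((le_max_left _ _).trans hS))
      · exact (ENNReal.ofReal_le_ofReal (min_le_right _ _)).trans
          (H' y hy f hf c σ Λ hfc hΛ hec he ((le_max_right _ _).trans hS))
    · intro x _
      obtain ⟨ρ, m, M, L, k, hc⟩ := exists_controlledChart J g x
      obtain ⟨h, S, hh, H⟩ := hc.exists_energyLowerBoundAt
      refine ⟨(chartAt E x).source ∩ extChartAt 𝓘(ℝ, E) x ⁻¹'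
        Metric.ball (extChartAt 𝓘(ℝ, E) x x) (ρ / 2), mem_nhdsWithin_of_mem_nhds (inter_mem
          ((chartAt E x).open_source.mem_nhds (mem_chart_source E x))
          ((continuousAt_extChartAt x).preimage_mem_nhds
            (Metric.ball_mem_nhds _ (half_pos hc.radius_pos)))), h, S, hh,
        fun y hy => H y hy.1 hy.2⟩
  obtain ⟨h, S, hh, H⟩ := key
  exact ⟨h, S, hh, fun y => H y (mem_univ y)⟩

/-- A continuous nonnegative function on the plane that does not vanish identically is controlled
by its value at some point, on a disk which is arbitrarily large after rescaling. -/
theorem exists_rescaling_point {e : ℂ → ℝ} (he : Continuous e) (h0 : ∀ z, 0 ≤ e z) {p : ℂ}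
    (hp : 0 < e p) (S : ℝ) :
    ∃ (c : ℂ) (σ Λ : ℝ), 0 < Λ ∧ e c = Λ ^ 2 ∧ (∀ z ∈ Metric.ball c σ, e z ≤ 4 * Λ ^ 2) ∧
      S ≤ σ * Λ := by
  have hp' : 0 < √(e p) := Real.sqrt_pos.2 hp
  -- Chosen so that the weighted function below equals `2 * |S| + 1` at `p`; its maximum is then at
  -- least that, and half of it still exceeds `S`.
  set R : ℝ := (2 * |S| + 1) / √(e p) with hR
  have hR0 : 0 < R := by positivity
  obtain ⟨c, hcR, hmax⟩ := (isCompact_closedBall p R).exists_isMaxOn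
    (f := fun z => (R - dist z p) * √(e z)) ⟨p, Metric.mem_closedBall_self hR0.le⟩
    (by fun_prop)
  have h1 : 2 * |S| + 1 ≤ (R - dist c p) * √(e c) := by
    have h2 := isMaxOn_iff.1 hmax p (Metric.mem_closedBall_self hR0.le)
    simp only [dist_self, sub_zero] at h2
    rwa [hR, div_mul_cancel₀ _ hp'.ne', ← hR] at h2
  have h2 : 0 < (R - dist c p) * √(e c) := by have := abs_nonneg S; linarith
  have h3 : 0 < √(e c) := pos_of_mul_pos_right h2 (sub_nonneg.2 hcR)
  have h4 : 0 < R - dist c p := pos_of_mul_pos_left h2 h3.le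
  -- On a disk of half the remaining radius the weight drops by at most a factor `2`, so maximality
  -- gives `√(e z) ≤ 2 * √(e c)`.
  refine ⟨c, (R - dist c p) / 2, √(e c), h3, (Real.sq_sqrt (h0 c)).symm, ?_, ?_⟩
  · intro z hz
    have h5 : dist z p ≤ dist z c + dist c p := dist_triangle _ _ _
    rw [Metric.mem_ball] at hz
    have h6 := isMaxOn_iff.1 hmax z (by rw [Metric.mem_closedBall]; linarith)
    have h7 : (R - dist c p) / 2 * √(e z) ≤ (R - dist z p) * √(e z) := by
      gcongr; linarith
    have h8 : √(e z) ≤ 2 * √(e c) := by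
      have : (R - dist c p) * √(e z) ≤ (R - dist c p) * (2 * √(e c)) := by linarith
      exact le_of_mul_le_mul_left this h4
    calc e z = √(e z) ^ 2 := (Real.sq_sqrt (h0 z)).symm
      _ ≤ (2 * √(e c)) ^ 2 := by gcongr
      _ = 4 * √(e c) ^ 2 := by ring
  · have := le_abs_self S
    linarith

/-- Energy quantization for `J`-holomorphic planes. -/
theorem exists_energy_lower_bound_plane [T2Space X] [CompactSpace X] [FiniteDimensional ℝ E]
    (J : AlmostComplexStructure E X) (g : SmoothRiemannianMetric E X) :
    ∃ h : ℝ, 0 < h ∧ ∀ f : ℂ → X, IsJHolomorphicPlane J f → (∃ z w, f z ≠ f w) →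
      ENNReal.ofReal h ≤ ∫⁻ z, ENNReal.ofReal (planeEnergyDensity g f z) := by
  obtain ⟨h, S, hh, H⟩ := exists_forall_energyLowerBoundAt J g
  refine ⟨h, hh, fun f hf ⟨z, w, hzw⟩ => ?_⟩
  obtain ⟨p, hp⟩ : ∃ p, planeEnergyDensity g f p ≠ 0 := by
    by_contra! hcon
    exact hzw (eq_of_planeEnergyDensity_eq_zero g hf.contMDiff hcon z w)
  obtain ⟨c, σ, Λ, hΛ, hec, he, hS⟩ := exists_rescaling_point
    (continuous_planeEnergyDensity g hf.contMDiff) (planeEnergyDensity_nonneg g f)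
    (lt_of_le_of_ne (planeEnergyDensity_nonneg g f p) hp.symm) S
  exact H (f c) f hf c σ Λ rfl hΛ hec he hS

end Quantization

/-! ### From the plane to the Riemann sphere. -/

section Sphere

variable {E : Type*} [NormedAddCommGroup E] [NormedSpace ℝ E]
  {X : Type*} [TopologicalSpace X] [ChartedSpace E X] [IsManifold 𝓘(ℝ, E) ∞ X]

namespace RiemannSphere

theorem chartAt_coe (z : ℂ) : chartAt ℂ (z : RiemannSphere) = chartZero :=
  if_neg (OnePoint.coe_ne_infty z)

theorem contMDiff_coe : ContMDiff 𝓘(ℝ, ℂ) 𝓘(ℝ, ℂ) ∞ ((↑) : ℂ → RiemannSphere) := by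
  have h1 : chartZero ∈ IsManifold.maximalAtlas 𝓘(ℝ, ℂ) ∞ RiemannSphere :=
    IsManifold.subset_maximalAtlas (Or.inl rfl)
  have h2 := contMDiffOn_symm_of_mem_maximalAtlas h1
  rw [chartZero_target, contMDiffOn_univ] at h2
  exact h2.congr fun z => (chartZero_symm_apply z).symm

/-- The preferred chart at every finite point is `chartZero`, in which the inclusion reads as the
identity. -/
theorem hasMFDerivAt_coe (z : ℂ) :
    HasMFDerivAt 𝓘(ℝ, ℂ) 𝓘(ℝ, ℂ) ((↑) : ℂ → RiemannSphere) z (ContinuousLinearMap.id ℝ ℂ) := by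
  refine ⟨OnePoint.continuous_coe.continuousAt, ?_⟩
  have h : writtenInExtChartAt 𝓘(ℝ, ℂ) 𝓘(ℝ, ℂ) z ((↑) : ℂ → RiemannSphere) = id := by
    funext w
    simp [writtenInExtChartAt, extChartAt, chartAt_coe, chartZero_coe, chartAt_self_eq]
  rw [h]
  exact hasFDerivWithinAt_id _ _

end RiemannSphere

theorem IsJHolomorphic.comp_coe {J : AlmostComplexStructure E X} {u : RiemannSphere → X}
    (hu : IsJHolomorphic J u) : IsJHolomorphicPlane J (fun z : ℂ => u (z : RiemannSphere)) where
  contMDiff := hu.1.comp RiemannSphere.contMDiff_coe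
  mfderiv_I_mul z w := by
    have h1 : HasMFDerivAt 𝓘(ℝ, ℂ) 𝓘(ℝ, E) u (z : RiemannSphere)
        (mfderiv 𝓘(ℝ, ℂ) 𝓘(ℝ, E) u (z : RiemannSphere)) :=
      (hu.1.mdifferentiableAt (by simp)).hasMFDerivAt
    have h2 : ∀ v : ℂ, mfderiv 𝓘(ℝ, ℂ) 𝓘(ℝ, E) (fun z : ℂ => u (z : RiemannSphere)) z v =
        mfderiv 𝓘(ℝ, ℂ) 𝓘(ℝ, E) u (z : RiemannSphere) v := fun v =>
      DFunLike.congr_fun (h1.comp z (RiemannSphere.hasMFDerivAt_coe z)).mfderiv v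
    rw [h2, h2]
    exact hu.2 (z : RiemannSphere) w

/-- The whole affine chart is a single admissible piece in the supremum defining `energy`. -/
theorem lintegral_planeEnergyDensity_le_energy (g : SmoothRiemannianMetric E X)
    (u : RiemannSphere → X) :
    ∫⁻ z, ENNReal.ofReal (planeEnergyDensity g (fun z : ℂ => u (z : RiemannSphere)) z) ≤
      energy g u := by
  have himg : RiemannSphere.chartZero '' RiemannSphere.chartZero.source = univ := by
    rw [OpenPartialHomeomorph.image_source_eq_target, RiemannSphere.chartZero_target]
  have h1 : ∫⁻ z, ENNReal.ofReal (planeEnergyDensity g (fun z : ℂ => u (z : RiemannSphere)) z) =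
      chartEnergy g RiemannSphere.chartZero u RiemannSphere.chartZero.source := by
    rw [chartEnergy, himg, Measure.restrict_univ]
    rfl
  have h2 : ∑ i : Fin 1, chartEnergy g ((fun _ => RiemannSphere.chartZero) i) u
      ((fun _ => RiemannSphere.chartZero.source) i) ≤ energy g u := by
    unfold energy
    refine le_iSup_of_le 1 (le_iSup_of_le (fun _ => RiemannSphere.chartZero)
      (le_iSup_of_le (fun _ => RiemannSphere.chartZero.source) ?_))
    refine le_iSup_of_le (fun _ => Or.inl rfl) (le_iSup_of_le (fun _ => ?_)
      (le_iSup_of_le (fun _ => le_rfl) (le_iSup_of_le ?_ le_rfl)))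
    · exact MeasurableSpace.measurableSet_generateFrom RiemannSphere.chartZero.open_source
    · exact fun i j hij => (hij (Subsingleton.elim i j)).elim
  rw [h1]
  simpa using h2

end Sphere

theorem corollary4p2
    {E : Type*} [NormedAddCommGroup E] [NormedSpace ℝ E] [FiniteDimensional ℝ E]
    {X : Type*} [TopologicalSpace X] [T2Space X] [CompactSpace X]
    [ChartedSpace E X] [IsManifold 𝓘(ℝ, E) ∞ X]
    (J : AlmostComplexStructure E X) (g : SmoothRiemannianMetric E X) :
    ∃ hbar : ℝ, 0 < hbar ∧
      ∀ u : RiemannSphere → X, IsJHolomorphic J u → (¬ ∃ c : X, ∀ z, u z = c) →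
        ENNReal.ofReal hbar ≤ energy g u := by
  obtain ⟨h, hh, H⟩ := exists_energy_lower_bound_plane J g
  refine ⟨h, hh, fun u hu hne => (H _ hu.comp_coe ?_).trans
    (lintegral_planeEnergyDensity_le_energy g u)⟩
  -- A map constant on the dense subset `ℂ` is constant on the sphere, by continuity into a
  -- Hausdorff space.
  by_contra! hcon
  have hconst : u = fun _ => u ((0 : ℂ) : RiemannSphere) :=
    (OnePoint.denseRange_coe (X := ℂ)).equalizer hu.1.continuous continuous_const
      (funext fun w => hcon w 0)
  exact hne ⟨_, congrFun hconst⟩
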